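/- **Definitions.** Let $G=(V,E)$ be a decomposable graph (no induced cycle of length $\ge 4$). It is called homogeneous if moreover $\mathrm{ne}(i)\cup\{i\}$ and $\mathrm{ne}(j)\cup\{j\}$ are comparable under inclusion for all adjacent $i,j$. Let $\mathcal P=(C_1,\dots,C_r)$ be a perfect order of its cliques (the maximal complete vertex sets), that is, an enumeration with the running intersection property; put $H_j=C_1\cup\dots\cup C_j$, $S_j=H_{j-1}\cap C_j$ ($j\ge2$), $c_j=|C_j|$, $s_j=|S_j|$. Multi-parameters $(\alpha,\beta)$ assign a real number $\alpha(C)$ to each clique and a real number $\beta(S)$ to each separator; write $\alpha_j=\alpha(C_j)$, $\beta_j=\beta(S_j)$. For a matrix $\Sigma$ with positive definite clique blocks put $$H_G(\alpha,\beta,\Sigma)=\frac{\prod_{j=1}^r\det(\Sigma_{C_j})^{\alpha_j}}{\prod_{j=2}^r\det(\Sigma_{S_j})^{\beta_j}},$$ and write $H_G\big(\tfrac{c+1}2,\tfrac{s+1}2,\Sigma\big)$ for the same ratio with exponents $\tfrac{c_j+1}2$ and $\tfrac{s_j+1}2$ instead of $\alpha_j$ and $\beta_j$. Let $P_G$ be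 the cone of positive definite matrices $\Omega$ with $\Omega_{ij}=0$ for distinct non-adjacent $i,j$, with Lebesgue measure $d\Omega$ in the entries along $E$ and the diagonal, and let $Q_G$ be the cone of incomplete symmetric matrices $U$ (entries specified along $E$ and the diagonal) all of whose clique blocks are positive definite. Put $$I_{\alpha,\beta}(U)=\int_{P_G}e^{-\mathrm{tr}(\Omega U)}\,H_G(\alpha,\beta,\Omega^{-1})\,H_G\big(\tfrac{c+1}2,\tfrac{s+1}2,\Omega^{-1}\big)\,d\Omega .$$ Condition (B1): $I_{\alpha,\beta}(U)<\infty$ for all $U\in Q_G$. Condition (B2): $I_{\alpha,\beta}(U)/H_G(\alpha,\beta,U)$ does not depend on $U\in Q_G$. Let $\mathcal B$ be the set of all $(\alpha,\beta)$ that satisfy (B1) and (B2). For a perfect order $\mathcal P$ with $r\ge2$ and a separator $S$ let $J(\mathcal P,S)=\{j:S_j=S\}$ and $\nu(S)=|J(\mathcal P,S)|$. For a number $\delta$, the set $B_{\mathcal P}$ consists of the $(\alpha,\beta)$ such that (a) $\sum_{j\in J(\mathcal P,S)}\big(\alpha_j+\tfrac{c_j-s_j}2\big)-\nu(S)\beta(S)=0$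 for each separator $S\ne S_2$; (b) $-\alpha_j-\tfrac{c_j-s_j-1}2>0$ for $j=2,\dots,r$, and $-\alpha_1-\tfrac{c_1-s_2-1}2>0$; (c) $-\alpha_1-\tfrac{c_1-s_2+\delta}2-\eta_2>\tfrac{s_2-1}2$, where $\eta_2=\sum_{j\in J(\mathcal P,S_2)}\big(\alpha_j+\tfrac{c_j-s_2}2\big)-\nu(S_2)\beta(S_2)$. Part (II) of the Letac–Massam conjecture says that for every non-homogeneous decomposable graph $\bigcup_{\mathcal P}B_{\mathcal P}=\mathcal B$, the union being over all perfect orders of the cliques. Everything below holds both for $\delta=1$ and for $\delta=0$ (two versions of the definition of $B_{\mathcal P}$). A DAG version $D$ of $G$ is a directed acyclic graph whose undirected version is $G$. It is induced by $\mathcal P$ if $H_1,\dots,H_{r-1}$ are ancestral in $D$ (a set is ancestral if it contains the parents of its members). Dimension means Hausdorff dimension, which for these sets is the dimension as a manifold (for a finite union, the largest dimension of its members). **Statement.** 1. Let $G$ have vertices $1,\dots,6$ and edges $14,26,35,36,45,46,56$. It is decomposable and not homogeneous. Let $\mathcal P=(\{3,5,6\},\{4,5,6\},\{2,6\},\{1,4\})$,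 with separators $S_2=\{5,6\}$, $S_3=\{6\}$, $S_4=\{4\}$. The orientation $D$ of $G$ with every edge directed from the larger to the smaller label is a DAG version of $G$ induced by $\mathcal P$. Exactly two separators of $G$ are ancestral in $D$, namely $S_2$ and $S_3$. Every $(\alpha,\beta)\in\mathbb R^4\times\mathbb R^3$ with $$\alpha_j<0\ (1\le j\le4),\quad \alpha_1+\alpha_2-\beta_2+1<0,\quad \alpha_1+\alpha_2+\alpha_3-\beta_2-\beta_3+2<0,\quad \alpha_4-\beta_4+\tfrac12=0$$ satisfies (B1) and (B2). The set of these $(\alpha,\beta)$ has dimension $6$, while $\bigcup_{\mathcal P}B_{\mathcal P}$ has dimension $5$; and $\bigcup_{\mathcal P}B_{\mathcal P}\subsetneq\mathcal B$. 2. Let $G$ have vertices $1,\dots,8$ and edges $15,16,25,26,56,68,37,38,47,48,78$. It is decomposable and not homogeneous. Let $\mathcal P=(\{4,7,8\},\{3,7,8\},\{6,8\},\{2,5,6\},\{1,5,6\})$, with separators $S_2=\{7,8\}$, $S_3=\{8\}$, $S_4=\{6\}$, $S_5=\{5,6\}$. The orientation $D$ of $G$ with every edge directed from the larger to the smaller label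 is a DAG version of $G$ induced by $\mathcal P$. Exactly two separators of $G$ are ancestral in $D$, namely $S_2$ and $S_3$. Every $(\alpha,\beta)\in\mathbb R^5\times\mathbb R^4$ with $$\alpha_j<0\ (1\le j\le5),\quad \alpha_1+\alpha_2-\beta_2+1<0,\quad \alpha_1+\alpha_2+\alpha_3-\beta_2-\beta_3+2<0,\quad \alpha_4+\alpha_5-\beta_5+1<0,$$ $$\alpha_4-\beta_4+1=0,\quad \alpha_5-\beta_5+\tfrac12=0$$ satisfies (B1) and (B2). The set of these $(\alpha,\beta)$ has dimension $7$, while $\bigcup_{\mathcal P}B_{\mathcal P}$ has dimension $6$; and $\bigcup_{\mathcal P}B_{\mathcal P}\subsetneq\mathcal B$. 3. Consequently part (II) of the Letac–Massam conjecture is false. -/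

import Mathlib

open scoped ENNReal

namespace LetacMassam

/-! ## Undirected graphs

Graphs carry no loops here; a vertex pair is "in the edge set with loops" if it is in
`closedEdges` below. -/

section Graphs

variable {V : Type*}

/-- A graph is decomposable (chordal) if it has no induced cycle of length at least four. -/
def Decomposable (G : SimpleGraph V) : Prop :=
  ∀ n : ℕ, 4 ≤ n → ¬ (SimpleGraph.cycleGraph n).IsIndContained G

/-- The closed neighbourhoods of any two adjacent vertices are comparable.  A homogeneous graph is
a decomposable graph with this property. -/
def HasNestedNeighborhoods (G : SimpleGraph V) : Prop :=
  ∀ i j : V, G.Adj i j →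
    insert j (G.neighborSet j) ⊆ insert i (G.neighborSet i) ∨
      insert i (G.neighborSet i) ⊆ insert j (G.neighborSet j)

/-- Homogeneous graphs. -/
def Homogeneous (G : SimpleGraph V) : Prop :=
  Decomposable G ∧ HasNestedNeighborhoods G

/-- The cliques of `G`: the complete vertex sets that are maximal under inclusion. -/
def IsMaxClique (G : SimpleGraph V) (C : Finset V) : Prop :=
  Maximal (fun s : Finset V => G.IsClique (s : Set V)) C

end Graphs

/-! ## Perfect orders of the cliques -/

section PerfectOrders

variable {V : Type*} [DecidableEq V]

/-- The history `C_1 ∪ ⋯ ∪ C_j` of a sequence of vertex sets. -/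
def history {n : ℕ} (C : Fin (n + 1) → Finset V) (j : Fin (n + 1)) : Finset V :=
  (Finset.univ.filter (fun i : Fin (n + 1) => i ≤ j)).biUnion C

/-- The separators `S_{j+1} = H_j ∩ C_{j+1}` of a sequence of `n + 1` vertex sets.  There are `n`
of them, and they are indexed from `0`, so that `separator C 0` is `S_2`. -/
def separator {n : ℕ} (C : Fin (n + 1) → Finset V) (j : Fin n) : Finset V :=
  history C j.castSucc ∩ C j.succ

/-- A perfect order `(C_1, …, C_r)`, `r = n + 1`, of the cliques of `G`: an enumeration without
repetition of the cliques with the running intersection property.  `clique 0` is `C_1`. -/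
structure PerfectOrder (G : SimpleGraph V) (n : ℕ) where
  clique : Fin (n + 1) → Finset V
  injective : Function.Injective clique
  isMaxClique_iff : ∀ C : Finset V, IsMaxClique G C ↔ ∃ j, clique j = C
  runningIntersection : ∀ j : Fin n, ∃ i : Fin (n + 1), i ≤ j.castSucc ∧
    separator clique j ⊆ clique i

/-- The set of cliques of `G`. -/
abbrev Cliques (G : SimpleGraph V) : Type _ := {C : Finset V // IsMaxClique G C}

/-- The set of (distinct) separators of `G`: those which occur in some perfect order. -/
abbrev Separators (G : SimpleGraph V) : Type _ :=
  {S : Finset V // ∃ (n : ℕ) (P : PerfectOrder G n) (j : Fin n), separator P.clique j = S}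

noncomputable instance instFintypeCliques [Fintype V] (G : SimpleGraph V) :
    Fintype (Cliques G) := Fintype.ofFinite _

noncomputable instance instFintypeSeparators [Fintype V] (G : SimpleGraph V) :
    Fintype (Separators G) := Fintype.ofFinite _

/-- The multi-parameters `(α, β)`: one number `α(C)` for each clique `C` and one number `β(S)` for
each separator `S`. -/
abbrev Params (G : SimpleGraph V) : Type _ := (Cliques G → ℝ) × (Separators G → ℝ)

namespace PerfectOrder

variable {G : SimpleGraph V} {n : ℕ} (P : PerfectOrder G n)

/-- The separator sequence of a perfect order; `P.sep 0` is `S_2`. -/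
def sep (j : Fin n) : Finset V := separator P.clique j

/-- The coordinate `α_j` of a multi-parameter; `P.alpha θ 0` is `α_1`. -/
def alpha (θ : Params G) (j : Fin (n + 1)) : ℝ :=
  θ.1 ⟨P.clique j, (P.isMaxClique_iff _).2 ⟨j, rfl⟩⟩

/-- The coordinate `β_j = β(S_j)` of a multi-parameter; `P.beta θ 0` is `β_2`. -/
def beta (θ : Params G) (j : Fin n) : ℝ :=
  θ.2 ⟨P.sep j, ⟨n, P, j, rfl⟩⟩

end PerfectOrder

end PerfectOrders

/-! ## The cones `P_G` and `Q_G` -/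

section Cones

variable {V : Type*}

/-- The edge set of `G` with all the loops. -/
def closedEdges (G : SimpleGraph V) : Set (Sym2 V) := {e | e.IsDiag ∨ e ∈ G.edgeSet}

/-- The real vector space `ℝ^E` of `G`-incomplete symmetric matrices, which also serves as the
coordinate space of the symmetric matrices that vanish off the edges. -/
abbrev IncompleteMatrix (G : SimpleGraph V) : Type _ := closedEdges G → ℝ

noncomputable instance instFintypeClosedEdges [Finite V] (G : SimpleGraph V) :
    Fintype (closedEdges G) := Fintype.ofFinite _

open Classical in
/-- The symmetric matrix with the given entries along the edges and the diagonal, and zeros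
elsewhere. -/
noncomputable def toMatrix (G : SimpleGraph V) (x : IncompleteMatrix G) : Matrix V V ℝ :=
  Matrix.of fun i j => if h : s(i, j) ∈ closedEdges G then x ⟨s(i, j), h⟩ else 0

/-- The principal submatrix with rows and columns in `A`. -/
def block (M : Matrix V V ℝ) (A : Finset V) : Matrix A A ℝ :=
  M.submatrix Subtype.val Subtype.val

/-- The cone `P_G` of positive definite matrices with zeros off the edges, in coordinates. -/
def concentrationCone (G : SimpleGraph V) : Set (IncompleteMatrix G) :=
  {x | (toMatrix G x).PosDef}

/-- The cone `Q_G` of partial positive definite matrices: all clique blocks are positive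
definite.  (Clique blocks only involve entries along the edges.) -/
def partialPosDefCone (G : SimpleGraph V) : Set (IncompleteMatrix G) :=
  {x | ∀ C : Finset V, IsMaxClique G C → (block (toMatrix G x) C).PosDef}

end Cones

/-! ## The Markov ratio, Type II Wishart distributions and the conjecture -/

namespace PerfectOrder

variable {V : Type*} [Fintype V] [DecidableEq V] {G : SimpleGraph V} {n : ℕ}
  (P : PerfectOrder G n)

/-- The Markov ratio `∏ det(M_{C_j})^{a_j} / ∏ det(M_{S_j})^{b_j}`.  Only the entries of `M` along
the edges matter, so that `M` may be any completion of an incomplete matrix. -/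
noncomputable def markovRatio (a : Fin (n + 1) → ℝ) (b : Fin n → ℝ) (M : Matrix V V ℝ) : ℝ :=
  (∏ j, (block M (P.clique j)).det ^ a j) / ∏ j, (block M (P.sep j)).det ^ b j

/-- The density with respect to Lebesgue measure `dΩ` of the measure
`exp(-tr(Ω U)) H(α, β, Ω^{-E}) ν_G(dΩ)`, where
`ν_G(dΩ) = H((c + 1) / 2, (s + 1) / 2, Ω^{-E}) dΩ`.  The trace only involves the entries of `U`
along the edges, because `Ω` vanishes elsewhere. -/
noncomputable def typeIIDensity (θ : Params G) (U Ω : IncompleteMatrix G) : ℝ :=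
  Real.exp (-((toMatrix G Ω) * (toMatrix G U)).trace) *
    P.markovRatio (P.alpha θ) (P.beta θ) (toMatrix G Ω)⁻¹ *
    P.markovRatio (fun j => (((P.clique j).card : ℝ) + 1) / 2)
      (fun j => (((P.sep j).card : ℝ) + 1) / 2) (toMatrix G Ω)⁻¹

/-- The integral of the non-normalized Type II Wishart density over `P_G`. -/
noncomputable def typeIIIntegral (θ : Params G) (U : IncompleteMatrix G) : ℝ≥0∞ :=
  ∫⁻ Ω in concentrationCone G, ENNReal.ofReal (P.typeIIDensity θ U Ω)

/-- Condition (B1): the integral is finite for every scale parameter. -/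
def CondB1 (θ : Params G) : Prop :=
  ∀ U ∈ partialPosDefCone G, P.typeIIIntegral θ U < ∞

/-- Condition (B2): the quotient of the integral by `H(α, β, U^E)` does not depend on the scale
parameter. -/
def CondB2 (θ : Params G) : Prop :=
  ∃ k : ℝ≥0∞, ∀ U ∈ partialPosDefCone G,
    P.typeIIIntegral θ U /
      ENNReal.ofReal (P.markovRatio (P.alpha θ) (P.beta θ) (toMatrix G U)) = k

/-- The space `𝓑` of multi-parameters of the Type II Wishart distributions. -/
def typeIIParams : Set (Params G) := {θ | P.CondB1 θ ∧ P.CondB2 θ}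

end PerfectOrder

section Conjecture

variable {V : Type*} [DecidableEq V] {G : SimpleGraph V} {n : ℕ}

/-- The set `J(P, S)` of the indices `j` with `S_j = S`. -/
def PerfectOrder.indices (P : PerfectOrder G n) (S : Finset V) : Finset (Fin n) :=
  Finset.univ.filter (fun j => P.sep j = S)

/-- The set `B_P` of a perfect order with at least two cliques.  Here `C_{j+1} = P.clique j.succ`
corresponds to `S_{j+1} = P.sep j`.  The number `δ` only enters the last condition, which is found
in the literature with `δ = 1` and with `δ = 0`. -/
def PerfectOrder.typeIISet (P : PerfectOrder G (n + 1)) (δ : ℝ) : Set (Params G) :=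
  {θ |
    (∀ i : Fin (n + 1), P.sep i ≠ P.sep 0 →
      ∑ j ∈ P.indices (P.sep i),
          (P.alpha θ j.succ + (((P.clique j.succ).card : ℝ) - (P.sep j).card) / 2)
        - ((P.indices (P.sep i)).card : ℝ) * P.beta θ i = 0) ∧
    (∀ j : Fin (n + 1),
      0 < -P.alpha θ j.succ - (((P.clique j.succ).card : ℝ) - (P.sep j).card - 1) / 2) ∧
    0 < -P.alpha θ 0 - (((P.clique 0).card : ℝ) - (P.sep 0).card - 1) / 2 ∧
    (((P.sep 0).card : ℝ) - 1) / 2 <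
      -P.alpha θ 0 - (((P.clique 0).card : ℝ) - (P.sep 0).card + δ) / 2
        - (∑ j ∈ P.indices (P.sep 0),
              (P.alpha θ j.succ + (((P.clique j.succ).card : ℝ) - (P.sep 0).card) / 2)
            - ((P.indices (P.sep 0)).card : ℝ) * P.beta θ 0)}

/-- The union of the sets `B_P` over all perfect orders `P` of the cliques of `G`. -/
def typeIIUnion (G : SimpleGraph V) (δ : ℝ) : Set (Params G) :=
  ⋃ (n : ℕ) (P : PerfectOrder G (n + 1)), P.typeIISet δ

/-- Part (II) of the Letac-Massam conjecture: for every non-homogeneous decomposable graph, the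
union of the sets `B_P` is equal to `𝓑`. -/
def ConjectureII (δ : ℝ) : Prop :=
  ∀ (p : ℕ) (G : SimpleGraph (Fin p)), Decomposable G → ¬ Homogeneous G →
    ∀ (n : ℕ) (P : PerfectOrder G n), typeIIUnion G δ = P.typeIIParams

end Conjecture

/-! ## Directed versions -/

section Directed

variable {V : Type*} [DecidableEq V]

/-- A directed graph without directed cycles (and without loops). -/
def IsDAG (D : Digraph V) : Prop := ∀ v : V, ¬ Relation.TransGen D.Adj v v

/-- A set of vertices is ancestral if it contains the parents of its members. -/
def IsAncestral (D : Digraph V) (A : Finset V) : Prop :=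
  ∀ u v : V, D.Adj u v → v ∈ A → u ∈ A

/-- `D` is a DAG version of `G`: it is a DAG whose undirected version is `G`. -/
def IsDAGVersion (D : Digraph V) (G : SimpleGraph V) : Prop :=
  IsDAG D ∧ ∀ u v : V, G.Adj u v ↔ D.Adj u v ∨ D.Adj v u

/-- The DAG version `D` of `G` is induced by the perfect order `P = (C_1, …, C_r)`: the histories
`H_1, …, H_{r-1}` are ancestral in `D`. -/
def PerfectOrder.Induces {G : SimpleGraph V} {n : ℕ} (P : PerfectOrder G n) (D : Digraph V) :
    Prop :=
  IsDAGVersion D G ∧ ∀ j : Fin n, IsAncestral D (history P.clique j.castSucc)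

/-- The set of the separators of `G` that are ancestral in `D`. -/
def ancestralSeparators (G : SimpleGraph V) (D : Digraph V) : Set (Separators G) :=
  {S | IsAncestral D S.1}

end Directed

/-- A criterion for checking that a list of vertex sets enumerates the cliques. -/
theorem isMaxClique_iff_of_cover {V : Type*} {G : SimpleGraph V} {m : ℕ} {C : Fin m → Finset V}
    (h1 : ∀ j, G.IsClique (C j : Set V))
    (h2 : ∀ i j, C i ⊆ C j → i = j)
    (h3 : ∀ s : Finset V, G.IsClique (s : Set V) → ∃ j, s ⊆ C j) (A : Finset V) :
    IsMaxClique G A ↔ ∃ j, C j = A := by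
  constructor
  · intro hA
    obtain ⟨j, hj⟩ := h3 A hA.1
    exact ⟨j, le_antisymm (hA.2 (h1 j) hj) hj⟩
  · rintro ⟨j, rfl⟩
    refine ⟨h1 j, fun s hs hjs => ?_⟩
    obtain ⟨k, hk⟩ := h3 s hs
    have hjk : j = k := h2 j k (le_trans hjs hk)
    subst hjk
    exact hk

/-! ## The graph on six vertices

The vertices `1, …, 6` are represented by `0, …, 5`. -/

/-- The parents are `pa(1) = {4}`, `pa(2) = {6}`, `pa(3) = pa(4) = {5, 6}`, `pa(5) = {6}`,
`pa(6) = ∅`; the pair `(u, v)` stands for the arrow `u → v`. -/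
def arrowsSix : List (Fin 6 × Fin 6) :=
  [(3, 0), (5, 1), (4, 2), (5, 2), (4, 3), (5, 3), (5, 4)]

/-- The DAG on six vertices. -/
def dagSix : Digraph (Fin 6) where
  Adj u v := (u, v) ∈ arrowsSix

/-- The graph on six vertices, with the edges `14, 26, 35, 36, 45, 46, 56`. -/
def graphSix : SimpleGraph (Fin 6) := SimpleGraph.fromRel (fun u v => (u, v) ∈ arrowsSix)

instance instDecidableRelSix : DecidableRel graphSix.Adj :=
  fun u v => decidable_of_iff (u ≠ v ∧ ((u, v) ∈ arrowsSix ∨ (v, u) ∈ arrowsSix)) Iff.rfl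

/-- The cliques `{3, 5, 6}, {4, 5, 6}, {2, 6}, {1, 4}`. -/
def cliquesSix : Fin 4 → Finset (Fin 6) := ![{2, 4, 5}, {3, 4, 5}, {1, 5}, {0, 3}]

set_option maxRecDepth 100000 in
set_option maxHeartbeats 4000000 in
/-- The perfect order `({3, 5, 6}, {4, 5, 6}, {2, 6}, {1, 4})`, with the separators
`S_2 = {5, 6}, S_3 = {6}, S_4 = {4}`. -/
def orderSix : PerfectOrder graphSix 3 where
  clique := cliquesSix
  injective := by decide
  isMaxClique_iff := isMaxClique_iff_of_cover
    (by simp only [SimpleGraph.IsClique, Set.Pairwise, Finset.mem_coe]; decide)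
    (by decide)
    (by simp only [SimpleGraph.IsClique, Set.Pairwise, Finset.mem_coe]; decide +kernel)
  runningIntersection := by decide

/-- The multi-parameters `(α, β)` in `ℝ^4 × ℝ^3` with `α_j < 0` for all `j`,
`α_1 + α_2 - β_2 + 1 < 0`, `α_1 + α_2 + α_3 - β_2 - β_3 + 2 < 0` and `α_4 - β_4 + 1/2 = 0`. -/
def familySix : Set (Params graphSix) :=
  {θ |
    (∀ j, orderSix.alpha θ j < 0) ∧
    orderSix.alpha θ 0 + orderSix.alpha θ 1 - orderSix.beta θ 0 + 1 < 0 ∧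
    orderSix.alpha θ 0 + orderSix.alpha θ 1 + orderSix.alpha θ 2
      - orderSix.beta θ 0 - orderSix.beta θ 1 + 2 < 0 ∧
    orderSix.alpha θ 3 - orderSix.beta θ 2 + 1 / 2 = 0}

/-! ## The graph on eight vertices

The vertices `1, …, 8` are represented by `0, …, 7`. -/

/-- The parents are `pa(1) = pa(2) = {5, 6}`, `pa(3) = pa(4) = {7, 8}`, `pa(5) = {6}`,
`pa(6) = {8}`, `pa(7) = {8}`, `pa(8) = ∅`; the pair `(u, v)` stands for the arrow `u → v`. -/
def arrowsEight : List (Fin 8 × Fin 8) :=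
  [(4, 0), (5, 0), (4, 1), (5, 1), (6, 2), (7, 2), (6, 3), (7, 3), (5, 4), (7, 5), (7, 6)]

/-- The DAG on eight vertices. -/
def dagEight : Digraph (Fin 8) where
  Adj u v := (u, v) ∈ arrowsEight

/-- The graph on eight vertices, with the edges `15, 16, 25, 26, 56, 68, 37, 38, 47, 48, 78`. -/
def graphEight : SimpleGraph (Fin 8) := SimpleGraph.fromRel (fun u v => (u, v) ∈ arrowsEight)

instance instDecidableRelEight : DecidableRel graphEight.Adj :=
  fun u v => decidable_of_iff (u ≠ v ∧ ((u, v) ∈ arrowsEight ∨ (v, u) ∈ arrowsEight)) Iff.rfl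

/-- The cliques `{4, 7, 8}, {3, 7, 8}, {6, 8}, {2, 5, 6}, {1, 5, 6}`. -/
def cliquesEight : Fin 5 → Finset (Fin 8) :=
  ![{3, 6, 7}, {2, 6, 7}, {5, 7}, {1, 4, 5}, {0, 4, 5}]

set_option maxRecDepth 100000 in
set_option maxHeartbeats 4000000 in
/-- The perfect order `({4, 7, 8}, {3, 7, 8}, {6, 8}, {2, 5, 6}, {1, 5, 6})`, with the separators
`S_2 = {7, 8}, S_3 = {8}, S_4 = {6}, S_5 = {5, 6}`. -/
def orderEight : PerfectOrder graphEight 4 where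
  clique := cliquesEight
  injective := by decide
  isMaxClique_iff := isMaxClique_iff_of_cover
    (by simp only [SimpleGraph.IsClique, Set.Pairwise, Finset.mem_coe]; decide)
    (by decide)
    (by simp only [SimpleGraph.IsClique, Set.Pairwise, Finset.mem_coe]; decide +kernel)
  runningIntersection := by decide

/-- The multi-parameters `(α, β)` in `ℝ^5 × ℝ^4` with `α_j < 0` for all `j`,
`α_1 + α_2 - β_2 + 1 < 0`, `α_1 + α_2 + α_3 - β_2 - β_3 + 2 < 0`, `α_4 + α_5 - β_5 + 1 < 0`,
`α_4 - β_4 + 1 = 0` and `α_5 - β_5 + 1/2 = 0`. -/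
def familyEight : Set (Params graphEight) :=
  {θ |
    (∀ j, orderEight.alpha θ j < 0) ∧
    orderEight.alpha θ 0 + orderEight.alpha θ 1 - orderEight.beta θ 0 + 1 < 0 ∧
    orderEight.alpha θ 0 + orderEight.alpha θ 1 + orderEight.alpha θ 2
      - orderEight.beta θ 0 - orderEight.beta θ 1 + 2 < 0 ∧
    orderEight.alpha θ 3 + orderEight.alpha θ 4 - orderEight.beta θ 3 + 1 < 0 ∧
    orderEight.alpha θ 3 - orderEight.beta θ 2 + 1 = 0 ∧
    orderEight.alpha θ 4 - orderEight.beta θ 3 + 1 / 2 = 0}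

end LetacMassam

namespace LetacMassam

/-! ## Volume preserving shears and product integrals -/

section Shear

open MeasureTheory

/-! Along a perfect elimination order every Ω in the cone is L D Lᵀ, where D = diag(ω) and column v
of the unit triangular L lives on v and its parents pa(v), the neighbours of larger rank. Use the
coordinates ω_v and L_{pv} ω_v. Passing to the entries of Ω adds to each coordinate a function of
coordinates of smaller rank, so Lebesgue measure is preserved (`exists_coordinates`). The trace
tr(ΩU) splits into one expression per vertex (`trace_concentration_mul`). For Σ = Ω⁻¹ one has det
Σ_{fa(v)} · ω_v = det Σ_{pa(v)}, where fa(v) = {v} ∪ pa(v) (`det_block_inv_concentration`).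

Hence, if the Markov ratios in the density multiply to ∏ ω_v^{s_v}, the integral is a product over
the vertices of a Gaussian integral in the parent coordinates and a gamma integral in ω_v. It is
finite when all gamma parameters s_v + |pa(v)|/2 + 1 are positive, and it equals a constant times
powers of block determinants of U (`lintegral_concentrationCone`). So (B1) and (B2) reduce to
matching exponents (`PerfectOrder.mem_typeIIParams`).

On both graphs, with the orientation D, a separator that is itself a family fa(v) has its own
exponent s_v, and its β stays free; a separator that is only a parent set imposes a linear equation.
On six vertices this is one equation, for {4}. On eight vertices it is one equation, for {6},
implied by the two equations of the family.

By contrast, condition (a) makes every β except β(S_2) a function of α, so each B_P has dimension at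
most r + 1, while the families have dimension r + 2. For the inclusion of the union in 𝓑, a finite
enumeration of the perfect orders shows that each B_P satisfies the exponent equations either of D
or of a second orientation, rooted at vertex 4 or 6 respectively. -/

theorem exists_measurePreserving_shear_single {ι : Type*} [Fintype ι] [DecidableEq ι] (e : ι)
    (g : (ι → ℝ) → ℝ) (hg : Measurable g)
    (hge : ∀ y y' : ι → ℝ, (∀ i, i ≠ e → y i = y' i) → g y = g y') :
    ∃ Ψ : (ι → ℝ) ≃ᵐ (ι → ℝ), MeasurePreserving Ψ volume volume ∧
      ∀ y, Ψ y = Function.update y e (y e + g y) := by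
  have hupd : ∀ (y : ι → ℝ) t, g (Function.update y e t) = g y := fun y t =>
    hge _ _ fun i hi => Function.update_of_ne hi _ _
  have hm : ∀ h : (ι → ℝ) → ℝ, Measurable h →
      Measurable fun y : ι → ℝ => Function.update y e (h y) := by
    intro h hh
    refine measurable_pi_lambda _ fun i => ?_
    by_cases hi : i = e
    · subst hi; simpa using hh
    · simpa [Function.update_of_ne hi] using measurable_pi_apply i
  let Ψ : (ι → ℝ) ≃ᵐ (ι → ℝ) :=
    { toFun := fun y => Function.update y e (y e + g y)
      invFun := fun y => Function.update y e (y e - g y)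
      left_inv := fun y => by simp [hupd]
      right_inv := fun y => by simp [hupd]
      measurable_toFun := hm _ ((measurable_pi_apply e).add hg)
      measurable_invFun := hm _ ((measurable_pi_apply e).sub hg) }
  refine ⟨Ψ, ?_, fun y => rfl⟩
  let Q := MeasurableEquiv.piEquivPiSubtypeProd (fun _ : ι => ℝ) (fun i => i ≠ e)
  have hQ : MeasurePreserving Q volume volume :=
    volume_preserving_piEquivPiSubtypeProd (fun _ : ι => ℝ) (fun i => i ≠ e)
  have hQs : Measurable fun a => g (Q.symm (a, fun _ => 0)) :=
    hg.comp (Q.symm.measurable.comp (measurable_id.prodMk measurable_const))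
  -- With the other coordinates fixed, the map translates the coordinate `e`; translation invariance
  -- on the fibres gives the claim.
  have hskew : MeasurePreserving
      (fun p : ({i // i ≠ e} → ℝ) × ({i // ¬ i ≠ e} → ℝ) =>
        (p.1, p.2 + fun _ => g (Q.symm (p.1, fun _ => 0)))) volume volume := by
    refine MeasurePreserving.skew_product (f := id) (MeasurePreserving.id _)
      (g := fun a c => c + fun _ => g (Q.symm (a, fun _ => 0))) ?_ ?_
    · refine measurable_snd.add (measurable_pi_lambda _ fun _ => ?_)
      exact hQs.comp measurable_fst
    · exact Filter.Eventually.of_forall fun a => map_add_right_eq_self _ _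
  have hcomp := hQ.symm.comp (hskew.comp hQ)
  convert hcomp using 1
  funext y
  have hgy : g (Q.symm ((Q y).1, fun _ => 0)) = g y := by
    refine hge _ _ fun i hi => ?_
    simp [Q, MeasurableEquiv.piEquivPiSubtypeProd, Equiv.piEquivPiSubtypeProd, hi]
  have hval : ∀ z : ({i // i ≠ e} → ℝ) × ({i // ¬ i ≠ e} → ℝ), ∀ i, Q.symm z i =
      if h : i ≠ e then z.1 ⟨i, h⟩ else z.2 ⟨i, h⟩ := fun z i => rfl
  funext i
  simp only [Function.comp_apply]
  rw [hval, hgy]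
  by_cases hi : i = e
  · subst hi
    have h1 : (Q y).2 ⟨i, by simp⟩ = y i := rfl
    simp [Ψ, h1]
  · have h1 : (Q y).1 ⟨i, hi⟩ = y i := rfl
    simp [Ψ, hi, h1]

/-- A map that adds to every coordinate a function of the coordinates of smaller rank preserves
Lebesgue measure. -/
theorem exists_measurePreserving_shear {ι : Type*} [Fintype ι] [DecidableEq ι] (r : ι → ℕ)
    (f : ι → (ι → ℝ) → ℝ) (hf : ∀ e, Measurable (f e))
    (hr : ∀ e (y y' : ι → ℝ), (∀ i, r i < r e → y i = y' i) → f e y = f e y') :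
    ∃ Ψ : (ι → ℝ) ≃ᵐ (ι → ℝ), MeasurePreserving Ψ volume volume ∧
      ∀ y e, Ψ y e = y e + f e y := by
  suffices H : ∀ s : Finset ι, ∃ Ψ : (ι → ℝ) ≃ᵐ (ι → ℝ), MeasurePreserving Ψ volume volume ∧
      ∀ y e, Ψ y e = y e + if e ∈ s then f e y else 0 by
    simpa using H Finset.univ
  intro s
  -- Coordinates are modified in order of decreasing rank: when `a` is treated, everything of
  -- smaller rank still has its original value, so `f a` sees the original `y`.
  induction s using Finset.induction_on_min_value r with
  | empty => exact ⟨MeasurableEquiv.refl _, MeasurePreserving.id _, by simp⟩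
  | insert a s ha hmin ih =>
    obtain ⟨Ψ, hΨ, hΨe⟩ := ih
    obtain ⟨Θ, hΘ, hΘe⟩ := exists_measurePreserving_shear_single a (f a) (hf a)
      (fun y y' h => hr a y y' fun i hi => h i (by rintro rfl; exact lt_irrefl _ hi))
    refine ⟨Ψ.trans Θ, hΘ.comp hΨ, fun y e => ?_⟩
    have h1 : f a (Ψ y) = f a y := by
      refine hr a _ _ fun i hi => ?_
      have : i ∉ s := fun his => absurd (hmin i his) (not_le.2 hi)
      simp [hΨe, this]
    rw [MeasurableEquiv.trans_apply, hΘe]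
    by_cases he : e = a
    · subst he
      simp [h1, hΨe, ha]
    · simp [he, hΨe]

theorem lintegral_pi_fin_prod {n : ℕ} {E : Fin n → Type*} [∀ i, MeasureSpace (E i)]
    [∀ i, SigmaFinite (volume : Measure (E i))] (f : ∀ i, E i → ℝ≥0∞) (hf : ∀ i, Measurable (f i)) :
    ∫⁻ x : ∀ i, E i, ∏ i, f i (x i) = ∏ i, ∫⁻ x, f i x := by
  induction n with
  | zero => simp [volume_pi]
  | succ n ih =>
    rw [← (volume_preserving_piFinSuccAbove E 0).symm.lintegral_comp_emb
      (MeasurableEquiv.measurableEmbedding _)]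
    simp_rw [MeasurableEquiv.piFinSuccAbove_symm_apply, Fin.insertNthEquiv,
      Fin.prod_univ_succ, Fin.insertNth_zero, Equiv.coe_fn_mk, Fin.cons_succ,
      Fin.zero_succAbove, Fin.cons_zero]
    rw [← ih (fun i => f i.succ) fun i => hf _]
    exact lintegral_prod_mul (hf 0).aemeasurable
      (Finset.measurable_prod _ fun i _ => (hf _).comp (measurable_pi_apply i)).aemeasurable

theorem lintegral_pi_prod {ι : Type*} [Fintype ι] {E : ι → Type*} [∀ i, MeasureSpace (E i)]
    [∀ i, SigmaFinite (volume : Measure (E i))] (f : ∀ i, E i → ℝ≥0∞) (hf : ∀ i, Measurable (f i)) :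
    ∫⁻ x : ∀ i, E i, ∏ i, f i (x i) = ∏ i, ∫⁻ x, f i x := by
  let e := (Fintype.equivFin ι).symm
  rw [← (volume_measurePreserving_piCongrLeft E e).lintegral_comp_emb
    (MeasurableEquiv.measurableEmbedding _)]
  simp_rw [← e.prod_comp, MeasurableEquiv.coe_piCongrLeft, Equiv.piCongrLeft_apply_apply]
  exact lintegral_pi_fin_prod _ fun i => hf _

theorem volume_measurePreserving_piCurry {ι : Type*} [Fintype ι] {κ : ι → Type*}
    [∀ i, Fintype (κ i)] :
    MeasurePreserving (MeasurableEquiv.piCurry fun (i : ι) (_ : κ i) => ℝ) volume volume := by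
  have h : MeasurePreserving (MeasurableEquiv.piCurry fun (i : ι) (_ : κ i) => ℝ).symm
      volume volume := by
    refine ⟨MeasurableEquiv.measurable _, ?_⟩
    symm
    refine Measure.pi_eq fun s hs => ?_
    rw [MeasurableEquiv.map_apply]
    have : (MeasurableEquiv.piCurry fun (i : ι) (_ : κ i) => ℝ).symm ⁻¹' Set.univ.pi s =
        Set.univ.pi fun i => Set.univ.pi fun j => s ⟨i, j⟩ := by
      ext y
      simp [MeasurableEquiv.coe_piCurry_symm, Set.mem_pi, Sigma.forall, Sigma.uncurry]
    rw [this, volume_pi_pi]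
    simp_rw [volume_pi_pi]
    rw [Fintype.prod_sigma]
  exact h.symm (MeasurableEquiv.piCurry fun (i : ι) (_ : κ i) => ℝ).symm

end Shear

/-! ## Gaussian and gamma integrals -/

section Integrals

open MeasureTheory Matrix

theorem lintegral_exp_neg_sq :
    ∫⁻ x : ℝ, ENNReal.ofReal (Real.exp (-(x * x))) = ENNReal.ofReal √Real.pi := by
  have h := integral_gaussian 1
  have hi := integrable_exp_neg_mul_sq (b := 1) one_pos
  rw [div_one] at h
  rw [← h, ofReal_integral_eq_lintegral_ofReal hi
    (Filter.Eventually.of_forall fun x => (Real.exp_pos _).le)]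
  refine lintegral_congr fun x => ?_
  congr 2
  ring

theorem lintegral_Ioi_rpow_mul_exp {p d : ℝ} (hp : 0 < p) (hd : 0 < d) :
    ∫⁻ t : ℝ, (if 0 < t then ENNReal.ofReal (Real.exp ((p - 1) * Real.log t - t * d)) else 0) =
      ENNReal.ofReal (Real.Gamma p) * ENNReal.ofReal (Real.exp (-p * Real.log d)) := by
  have h := Real.integral_rpow_mul_exp_neg_mul_Ioi hp hd
  have hΓ := Real.Gamma_pos_of_pos hp
  have hval : (1 / d) ^ p * Real.Gamma p = Real.Gamma p * Real.exp (-p * Real.log d) := by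
    rw [Real.rpow_def_of_pos (by positivity), one_div, Real.log_inv, mul_comm]
    congr 2
    ring
  have hne : ∫ t : ℝ in Set.Ioi 0, t ^ (p - 1) * Real.exp (-(d * t)) ≠ 0 := by
    rw [h]; positivity
  -- The integral of a non-integrable function is 0 by convention, so the nonzero closed form proves
  -- integrability.
  have hi : IntegrableOn (fun t : ℝ => t ^ (p - 1) * Real.exp (-(d * t))) (Set.Ioi 0) :=
    Classical.byContradiction fun hc => hne (integral_undef hc)
  rw [← ENNReal.ofReal_mul hΓ.le, ← hval, ← h, ofReal_integral_eq_lintegral_ofReal hi,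
    ← lintegral_indicator measurableSet_Ioi]
  · refine lintegral_congr fun t => ?_
    by_cases ht : 0 < t
    · rw [if_pos ht, Set.indicator_of_mem (Set.mem_Ioi.2 ht), Real.rpow_def_of_pos ht,
        ← Real.exp_add]
      congr 2
      ring
    · rw [if_neg ht, Set.indicator_of_notMem (by simpa using ht)]
  · refine (ae_restrict_mem measurableSet_Ioi).mono fun t ht => ?_
    have : 0 < t := ht
    positivity

variable {κ : Type*} [Fintype κ] [DecidableEq κ]

open scoped MatrixOrder in
theorem exists_transpose_mul_self {A : Matrix κ κ ℝ} (hA : A.PosDef) :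
    ∃ B : Matrix κ κ ℝ, A = Bᵀ * B ∧ B.det ^ 2 = A.det := by
  obtain ⟨B, hB⟩ := CStarAlgebra.nonneg_iff_eq_star_mul_self.mp hA.posSemidef.nonneg
  have hB' : A = Bᵀ * B := by
    rw [hB, star_eq_conjTranspose, conjTranspose_eq_transpose_of_trivial]
  exact ⟨B, hB', by rw [hB', det_mul, det_transpose, sq]⟩

/-- Writing A = BᵀB and substituting z = Bw gives a product of one-dimensional Gaussians, with
Jacobian |det B|⁻¹ = (det A)^(-1/2). -/
theorem lintegral_exp_neg_quadratic {A : Matrix κ κ ℝ} (hA : A.PosDef) :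
    ∫⁻ w : κ → ℝ, ENNReal.ofReal (Real.exp (-(w ⬝ᵥ A *ᵥ w))) =
      ENNReal.ofReal (√Real.pi ^ Fintype.card κ) *
        ENNReal.ofReal (Real.exp (-(1 / 2) * Real.log A.det)) := by
  obtain ⟨B, hB, hdet⟩ := exists_transpose_mul_self hA
  have hpos := hA.det_pos
  have hB0 : B.det ≠ 0 := by
    intro h; rw [h] at hdet; rw [← hdet] at hpos; simp at hpos
  have hq : ∀ w : κ → ℝ, w ⬝ᵥ A *ᵥ w = ∑ i, (B *ᵥ w) i * (B *ᵥ w) i := by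
    intro w
    rw [hB, ← mulVec_mulVec, dotProduct_mulVec, vecMul_transpose]
    rfl
  have hprod : ∀ z : κ → ℝ, ENNReal.ofReal (Real.exp (-∑ i, z i * z i)) =
      ∏ i, ENNReal.ofReal (Real.exp (-(z i * z i))) := by
    intro z
    rw [← ENNReal.ofReal_prod_of_nonneg fun i _ => (Real.exp_pos _).le, ← Real.exp_sum,
      Finset.sum_neg_distrib]
  have hmeas : Measurable fun z : κ → ℝ => ∏ i, ENNReal.ofReal (Real.exp (-(z i * z i))) := by
    fun_prop
  have hmap := Real.map_matrix_volume_pi_eq_smul_volume_pi hB0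
  have hlin : Measurable (toLin' B) := (LinearMap.continuous_of_finiteDimensional _).measurable
  simp_rw [hq, hprod]
  calc ∫⁻ w : κ → ℝ, ∏ i, ENNReal.ofReal (Real.exp (-((B *ᵥ w) i * (B *ᵥ w) i)))
      = ∫⁻ z, ∏ i, ENNReal.ofReal (Real.exp (-(z i * z i))) ∂(Measure.map (toLin' B) volume) := by
        rw [lintegral_map hmeas hlin]
        rfl
    _ = ENNReal.ofReal |B.det⁻¹| * ENNReal.ofReal √Real.pi ^ Fintype.card κ := by
        rw [hmap, lintegral_smul_measure,
          lintegral_pi_prod (fun (_ : κ) x => ENNReal.ofReal (Real.exp (-(x * x))))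
            (fun _ => by fun_prop)]
        simp [lintegral_exp_neg_sq]
    _ = _ := by
        rw [mul_comm, ENNReal.ofReal_pow (Real.sqrt_nonneg _)]
        congr 2
        rw [← hdet, ← sq_abs, Real.log_pow, abs_inv]
        push_cast
        rw [show -(1 / 2) * (2 * Real.log |B.det|) = -Real.log |B.det| by ring, Real.exp_neg,
          Real.exp_log (abs_pos.2 hB0)]

/-- The integrand that belongs to a vertex with the set `κ` of parents. -/
noncomputable def vertexFactor (s : ℝ) (A : Matrix κ κ ℝ) (b : κ → ℝ) (D : ℝ)
    (y : κ ⊕ Unit → ℝ) : ℝ≥0∞ :=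
  if 0 < y (Sum.inr ()) then
    ENNReal.ofReal (Real.exp (s * Real.log (y (Sum.inr ())) -
      (y (Sum.inr ()) * D + 2 * ((fun p => y (Sum.inl p)) ⬝ᵥ b) +
        ((fun p => y (Sum.inl p)) ⬝ᵥ A *ᵥ fun p => y (Sum.inl p)) / y (Sum.inr ()))))
  else 0

theorem measurable_vertexFactor (s : ℝ) (A : Matrix κ κ ℝ) (b : κ → ℝ) (D : ℝ) :
    Measurable (vertexFactor s A b D) := by
  unfold vertexFactor
  simp only [dotProduct, mulVec]
  refine Measurable.ite (measurableSet_lt measurable_const (by fun_prop)) ?_ measurable_const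
  fun_prop

theorem quadratic_complete_square {A : Matrix κ κ ℝ} (hA : A.PosDef) (b w : κ → ℝ) {t : ℝ}
    (ht : 0 < t) :
    2 * (w ⬝ᵥ b) + (w ⬝ᵥ A *ᵥ w) / t =
      (w + t • A⁻¹ *ᵥ b) ⬝ᵥ (t⁻¹ • A) *ᵥ (w + t • A⁻¹ *ᵥ b) - t * (b ⬝ᵥ A⁻¹ *ᵥ b) := by
  have hAb : A *ᵥ A⁻¹ *ᵥ b = b := by
    rw [mulVec_mulVec, mul_nonsing_inv _ (isUnit_iff_ne_zero.2 hA.det_pos.ne'), one_mulVec]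
  have hsym : Aᵀ = A := by
    rw [← conjTranspose_eq_transpose_of_trivial]; exact hA.isHermitian
  have h1 : (A⁻¹ *ᵥ b) ⬝ᵥ A *ᵥ w = w ⬝ᵥ b := by
    rw [dotProduct_mulVec, ← mulVec_transpose, hsym, hAb, dotProduct_comm]
  have h2 : (A⁻¹ *ᵥ b) ⬝ᵥ b = b ⬝ᵥ A⁻¹ *ᵥ b := dotProduct_comm _ _
  simp only [smul_mulVec, mulVec_add, mulVec_smul, hAb, add_dotProduct, dotProduct_add,
    smul_dotProduct, dotProduct_smul, smul_eq_mul, h1, h2]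
  field_simp
  ring

/-- After completing the square, a translation leaves a centred Gaussian with matrix A/t. Its
determinant contributes the factor t^(card κ / 2), which shifts the gamma parameter, and D is
replaced by its Schur complement. -/
theorem lintegral_vertexFactor_inl {s D t : ℝ} (ht : 0 < t) {A : Matrix κ κ ℝ} (hA : A.PosDef)
    (b : κ → ℝ) :
    ∫⁻ w : κ → ℝ, ENNReal.ofReal (Real.exp (s * Real.log t -
        (t * D + 2 * (w ⬝ᵥ b) + (w ⬝ᵥ A *ᵥ w) / t))) =
      ENNReal.ofReal (√Real.pi ^ Fintype.card κ) *
        (ENNReal.ofReal (Real.exp (-(1 / 2) * Real.log A.det)) *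
          ENNReal.ofReal (Real.exp ((s + (Fintype.card κ : ℝ) / 2) * Real.log t
            - t * (D - b ⬝ᵥ A⁻¹ *ᵥ b)))) := by
  have hA' : (t⁻¹ • A).PosDef := hA.smul (inv_pos.2 ht)
  have hsplit : ∀ w : κ → ℝ, ENNReal.ofReal (Real.exp (s * Real.log t -
        (t * D + 2 * (w ⬝ᵥ b) + (w ⬝ᵥ A *ᵥ w) / t))) =
      ENNReal.ofReal (Real.exp (s * Real.log t - t * (D - b ⬝ᵥ A⁻¹ *ᵥ b))) *
        ENNReal.ofReal (Real.exp (-((w + t • A⁻¹ *ᵥ b) ⬝ᵥ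
          (t⁻¹ • A) *ᵥ (w + t • A⁻¹ *ᵥ b)))) := by
    intro w
    rw [← ENNReal.ofReal_mul (Real.exp_pos _).le, ← Real.exp_add, add_assoc (t * D),
      quadratic_complete_square hA b w ht]
    congr 2
    ring
  simp_rw [hsplit]
  rw [lintegral_const_mul' _ _ ENNReal.ofReal_ne_top,
    lintegral_add_right_eq_self
      (fun w : κ → ℝ => ENNReal.ofReal (Real.exp (-(w ⬝ᵥ (t⁻¹ • A) *ᵥ w)))),
    lintegral_exp_neg_quadratic hA', mul_left_comm]
  congr 1
  rw [← ENNReal.ofReal_mul (Real.exp_pos _).le, ← ENNReal.ofReal_mul (Real.exp_pos _).le,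
    ← Real.exp_add, ← Real.exp_add, det_smul, Real.log_mul (by positivity) hA.det_pos.ne',
    Real.log_pow, Real.log_inv]
  congr 2
  ring

theorem lintegral_vertexFactor {s D : ℝ} {A : Matrix κ κ ℝ} (hA : A.PosDef) (b : κ → ℝ)
    (hD : 0 < D - b ⬝ᵥ A⁻¹ *ᵥ b) (hs : 0 < s + (Fintype.card κ : ℝ) / 2 + 1) :
    ∫⁻ y, vertexFactor s A b D y =
      ENNReal.ofReal (√Real.pi ^ Fintype.card κ) *
        ENNReal.ofReal (Real.Gamma (s + (Fintype.card κ : ℝ) / 2 + 1)) *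
        ENNReal.ofReal (Real.exp (-(s + (Fintype.card κ : ℝ) / 2 + 1) *
          Real.log (D - b ⬝ᵥ A⁻¹ *ᵥ b) - 1 / 2 * Real.log A.det)) := by
  have hm := measurable_vertexFactor s A b D
  rw [← (volume_measurePreserving_sumPiEquivProdPi_symm fun _ : κ ⊕ Unit => ℝ).lintegral_comp_emb
    (MeasurableEquiv.measurableEmbedding _)]
  have hm' : Measurable fun z => vertexFactor s A b D
      ((MeasurableEquiv.sumPiEquivProdPi fun _ : κ ⊕ Unit => ℝ).symm z) :=
    hm.comp (MeasurableEquiv.measurable _)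
  rw [Measure.volume_eq_prod, lintegral_prod_symm _ hm'.aemeasurable]
  rw [← (volume_preserving_funUnique Unit ℝ).symm.lintegral_comp_emb
    (MeasurableEquiv.measurableEmbedding _)]
  have hinner : ∀ t : ℝ, ∫⁻ w : κ → ℝ, vertexFactor s A b D
        ((MeasurableEquiv.sumPiEquivProdPi fun _ : κ ⊕ Unit => ℝ).symm
          (w, (MeasurableEquiv.funUnique Unit ℝ).symm t)) =
      ENNReal.ofReal (√Real.pi ^ Fintype.card κ) *
        (ENNReal.ofReal (Real.exp (-(1 / 2) * Real.log A.det)) *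
        if 0 < t then ENNReal.ofReal (Real.exp ((s + (Fintype.card κ : ℝ) / 2 + 1 - 1) * Real.log t
            - t * (D - b ⬝ᵥ A⁻¹ *ᵥ b))) else 0) := by
    intro t
    by_cases ht : 0 < t
    · rw [if_pos ht, add_sub_cancel_right, ← lintegral_vertexFactor_inl ht hA b]
      refine lintegral_congr fun w => ?_
      exact if_pos ht
    · rw [if_neg ht, mul_zero, mul_zero]
      refine (lintegral_congr fun w => ?_).trans lintegral_zero
      exact if_neg ht
  simp_rw [hinner]
  rw [lintegral_const_mul' _ _ ENNReal.ofReal_ne_top,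
    lintegral_const_mul' _ _ ENNReal.ofReal_ne_top, lintegral_Ioi_rpow_mul_exp hs hD, mul_assoc]
  congr 1
  rw [mul_left_comm, ← ENNReal.ofReal_mul (Real.exp_pos _).le, ← Real.exp_add]
  congr 3
  ring

end Integrals

/-! ## Coordinates adapted to a perfect elimination order -/

section Elimination

variable {V : Type*}

/-- The rank `r` orders the vertices in such a way that the neighbours of larger rank of every
vertex are pairwise adjacent. -/
def IsPerfectElimination (G : SimpleGraph V) (r : V → ℕ) : Prop :=
  Function.Injective r ∧ ∀ v u w, G.Adj v u → G.Adj v w → r v < r u → r v < r w → u ≠ w → G.Adj u w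

open Classical in
/-- The neighbours of larger rank. -/
noncomputable def parents [Fintype V] (G : SimpleGraph V) (r : V → ℕ) (v : V) : Finset V :=
  Finset.univ.filter fun u => G.Adj v u ∧ r v < r u

theorem mem_parents [Fintype V] {G : SimpleGraph V} {r : V → ℕ} {u v : V} :
    u ∈ parents G r v ↔ G.Adj v u ∧ r v < r u := by
  simp [parents]

theorem self_notMem_parents [Fintype V] {G : SimpleGraph V} {r : V → ℕ} {v : V} :
    v ∉ parents G r v := by
  simp [mem_parents]

theorem toMatrix_comm (G : SimpleGraph V) (x : IncompleteMatrix G) (i j : V) :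
    toMatrix G x i j = toMatrix G x j i := by
  classical
  exact congrArg (fun e : Sym2 V => if h : e ∈ closedEdges G then x ⟨e, h⟩ else 0) Sym2.eq_swap

theorem posDef_block_of_subset {M : Matrix V V ℝ} {A B : Finset V} (h : A ⊆ B)
    (hM : (block M B).PosDef) : (block M A).PosDef :=
  hM.submatrix (e := fun a : A => (⟨a.1, h a.2⟩ : B))
    (fun _ _ hab => Subtype.ext (congrArg (fun z : B => (z : V)) hab))

theorem posDef_block {M : Matrix V V ℝ} (hM : M.PosDef) (A : Finset V) : (block M A).PosDef :=
  hM.submatrix Subtype.val_injective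

/-- The elements of `insert v Q`, split into those of `Q` and `v`. -/
noncomputable def insertEquiv [DecidableEq V] {v : V} {Q : Finset V} (hv : v ∉ Q) :
    Q ⊕ Unit ≃ (insert v Q : Finset V) :=
  Equiv.ofBijective
    (Sum.elim (fun p => ⟨p.1, Finset.mem_insert_of_mem p.2⟩)
      fun _ => ⟨v, Finset.mem_insert_self v Q⟩) (by
    constructor
    · rintro (⟨p, hp⟩ | _) (⟨q, hq⟩ | _) h
      · simpa using h
      · simp only [Sum.elim_inl, Sum.elim_inr, Subtype.mk.injEq] at h
        exact absurd (h ▸ hp) hv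
      · simp only [Sum.elim_inl, Sum.elim_inr, Subtype.mk.injEq] at h
        exact absurd (h ▸ hq) hv
      · rfl
    · rintro ⟨x, hx⟩
      rcases Finset.mem_insert.1 hx with rfl | h
      · exact ⟨Sum.inr (), rfl⟩
      · exact ⟨Sum.inl ⟨x, h⟩, rfl⟩)

open Matrix in
theorem det_block_insert [DecidableEq V] {M : Matrix V V ℝ} (hM : ∀ i j, M i j = M j i) {v : V} {Q : Finset V}
    (hv : v ∉ Q) (hQ : (block M Q).PosDef) :
    (block M (insert v Q)).det = (block M Q).det *
      (M v v - (fun p : Q => M p v) ⬝ᵥ (block M Q)⁻¹ *ᵥ fun p : Q => M p v) := by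
  have hsub : (block M (insert v Q)).submatrix (insertEquiv hv) (insertEquiv hv) =
      fromBlocks (block M Q) (of fun (p : Q) (_ : Unit) => M p v)
        (of fun (_ : Unit) (p : Q) => M p v) (of fun _ _ => M v v) := by
    ext (i | i) (j | j)
    · rfl
    · rfl
    · exact hM _ _
    · rfl
  let hinv : Invertible (block M Q) :=
    invertibleOfIsUnitDet _ (isUnit_iff_ne_zero.2 hQ.det_pos.ne')
  rw [← det_submatrix_equiv_self (insertEquiv hv), hsub, det_fromBlocks₁₁, det_unique (n := Unit),
    invOf_eq_nonsing_inv]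
  congr 1
  simp [Matrix.mul_apply, dotProduct, mulVec, Finset.sum_mul, Finset.mul_sum, mul_assoc]
  rw [Finset.sum_comm]

variable [Fintype V] {G : SimpleGraph V} {r : V → ℕ}

theorem exists_isMaxClique_superset {C : Finset V} (hC : G.IsClique (C : Set V)) :
    ∃ D, C ⊆ D ∧ IsMaxClique G D := by
  obtain ⟨D, hCD, hD⟩ :=
    (Set.toFinite {s : Finset V | G.IsClique (s : Set V)}).exists_le_maximal hC
  exact ⟨D, hCD, hD⟩

theorem posDef_block_of_isClique {U : IncompleteMatrix G} (hU : U ∈ partialPosDefCone G)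
    {C : Finset V} (hC : G.IsClique (C : Set V)) : (block (toMatrix G U) C).PosDef := by
  obtain ⟨D, hCD, hD⟩ := exists_isMaxClique_superset hC
  exact posDef_block_of_subset hCD (hU D hD)

variable (G r) in
/-- The coordinates of the concentration matrices: every vertex contributes itself and its
parents. -/
abbrev Coord : Type _ := Σ v : V, (parents G r v) ⊕ Unit

/-- The second vertex of a coordinate. -/
def Coord.vertex (e : Coord G r) : V := Sum.elim (fun p => p.1) (fun _ => e.1) e.2

/-- The edge or loop of a coordinate. -/
def Coord.edge (e : Coord G r) : closedEdges G :=
  ⟨s(e.vertex, e.1), by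
    obtain ⟨v, ⟨p, hp⟩ | _⟩ := e
    · exact Or.inr (mem_parents.1 hp).1.symm
    · exact Or.inl rfl⟩

theorem Coord.rank_le (e : Coord G r) : r e.1 ≤ r e.vertex := by
  obtain ⟨v, ⟨p, hp⟩ | _⟩ := e
  · exact (mem_parents.1 hp).2.le
  · exact le_rfl

theorem Coord.ext_vertex {e e' : Coord G r} (h1 : e.1 = e'.1) (h2 : e.vertex = e'.vertex) :
    e = e' := by
  obtain ⟨v, ⟨p, hp⟩ | _⟩ := e <;> obtain ⟨v', ⟨p', hp'⟩ | _⟩ := e' <;>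
    obtain rfl : v = v' := h1 <;> simp only [Coord.vertex, Sum.elim_inl, Sum.elim_inr] at h2
  · subst h2; rfl
  · subst h2; exact absurd hp self_notMem_parents
  · subst h2; exact absurd hp' self_notMem_parents
  · rfl

/-- Ranks are injective, so each edge has exactly one endpoint of smaller rank, and it is recorded
as a coordinate of that endpoint. -/
theorem IsPerfectElimination.bijective_edge (hr : IsPerfectElimination G r) :
    Function.Bijective (Coord.edge : Coord G r → closedEdges G) := by
  constructor
  · intro e e' h
    have h' : s(e.vertex, e.1) = s(e'.vertex, e'.1) := congrArg Subtype.val h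
    rcases Sym2.eq_iff.1 h' with ⟨h1, h2⟩ | ⟨h1, h2⟩
    · exact Coord.ext_vertex h2 h1
    · have := e.rank_le
      have := e'.rank_le
      have h3 : e'.1 = e'.vertex := by
        refine hr.1 ?_
        rw [h1, h2] at *
        omega
      exact Coord.ext_vertex (by rw [h2, h3]) (by rw [h1, h3])
  · rintro ⟨e, he⟩
    induction e with
    | _ u v =>
    rcases he with he | he
    · obtain rfl : u = v := he
      exact ⟨⟨u, Sum.inr ()⟩, rfl⟩
    · have huv : G.Adj u v := he
      rcases lt_trichotomy (r u) (r v) with h | h | h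
      · exact ⟨⟨u, Sum.inl ⟨v, mem_parents.2 ⟨huv, h⟩⟩⟩, Subtype.ext Sym2.eq_swap⟩
      · exact absurd (hr.1 h) huv.ne
      · exact ⟨⟨v, Sum.inl ⟨u, mem_parents.2 ⟨huv.symm, h⟩⟩⟩, rfl⟩

variable [DecidableEq V]


theorem IsPerfectElimination.isClique_insert_parents (hr : IsPerfectElimination G r) (v : V) :
    G.IsClique (insert v (parents G r v) : Finset V) := by
  intro a ha b hb hab
  simp only [Finset.coe_insert, Set.mem_insert_iff, Finset.mem_coe, mem_parents] at ha hb
  rcases ha with rfl | ⟨ha, ha'⟩ <;> rcases hb with rfl | ⟨hb, hb'⟩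
  · exact absurd rfl hab
  · exact hb
  · exact ha.symm
  · exact hr.2 v a b ha hb ha' hb' hab

/-- The regression coefficients, with units on the diagonal. -/
noncomputable def loading (y : Coord G r → ℝ) : Matrix V V ℝ :=
  Matrix.of fun u v => if u = v then 1 else
    if h : u ∈ parents G r v then y ⟨v, Sum.inl ⟨u, h⟩⟩ / y ⟨v, Sum.inr ()⟩ else 0

/-- The conditional concentration of a vertex. -/
def weight (y : Coord G r → ℝ) (v : V) : ℝ := y ⟨v, Sum.inr ()⟩

/-- The concentration matrix with the given coordinates. -/
noncomputable def concentration (y : Coord G r → ℝ) : Matrix V V ℝ :=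
  loading y * Matrix.diagonal (weight y) * (loading y).transpose

theorem concentration_apply (y : Coord G r → ℝ) (i j : V) :
    concentration y i j = ∑ c, loading y i c * weight y c * loading y j c := by
  simp [concentration, Matrix.mul_apply, Matrix.diagonal_apply]

@[simp] theorem loading_self (y : Coord G r → ℝ) (v : V) : loading y v v = 1 := by
  simp [loading]

theorem loading_parent (y : Coord G r → ℝ) {v : V} (p : parents G r v) :
    loading y p v = y ⟨v, Sum.inl p⟩ / weight y v := by
  have h : (p : V) ≠ v := fun h => self_notMem_parents (h ▸ p.2)
  simp [loading, weight, h]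

theorem eq_or_mem_of_loading_ne_zero {y : Coord G r → ℝ} {u v : V} (h : loading y u v ≠ 0) :
    u = v ∨ u ∈ parents G r v := by
  by_contra! hc
  exact h (by simp [loading, hc.1, hc.2])

theorem loading_eq_zero_of_rank_lt (y : Coord G r → ℝ) {u v : V} (h : r u < r v) :
    loading y u v = 0 := by
  by_contra hc
  rcases eq_or_mem_of_loading_ne_zero hc with rfl | hm
  · exact lt_irrefl _ h
  · exact lt_asymm h (mem_parents.1 hm).2

theorem sum_loading_mul (y : Coord G r → ℝ) (v : V) (g : V → ℝ) :
    ∑ u, loading y u v * g u = g v + ∑ p : parents G r v, loading y p v * g p := by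
  rw [Finset.sum_coe_sort (parents G r v) fun u => loading y u v * g u]
  have h : ∑ u ∈ insert v (parents G r v), loading y u v * g u = ∑ u, loading y u v * g u := by
    refine Finset.sum_subset (Finset.subset_univ _) fun u _ hu => ?_
    by_cases h : loading y u v = 0
    · simp [h]
    · rcases eq_or_mem_of_loading_ne_zero h with rfl | h'
      · simp at hu
      · exact absurd (Finset.mem_insert_of_mem h') hu
  rw [← h, Finset.sum_insert self_notMem_parents]
  simp

/-- In the sum for this entry the term c = e.1 gives back `y e`, terms of larger rank vanish by
triangularity, and the rest involve coordinates of smaller rank only. This is the shear structure.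
-/
theorem concentration_coord (hr : IsPerfectElimination G r) (y : Coord G r → ℝ)
    (hy : ∀ v, weight y v ≠ 0) (e : Coord G r) :
    concentration y e.vertex e.1 = y e +
      ∑ c ∈ Finset.univ.filter (fun c => r c < r e.1),
        loading y e.vertex c * weight y c * loading y e.1 c := by
  rw [concentration_apply, ← Finset.sum_erase_add _ _ (Finset.mem_univ e.1), add_comm]
  congr 1
  · obtain ⟨v, p | _⟩ := e
    · change loading y p v * weight y v * loading y v v = _
      rw [loading_parent, loading_self, mul_one, div_mul_cancel₀ _ (hy v)]
    · change loading y v v * weight y v * loading y v v = _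
      simp [weight]
  · symm
    refine Finset.sum_subset (fun c hc => ?_) fun c hc hc' => ?_
    · simp only [Finset.mem_filter, Finset.mem_univ, true_and] at hc
      simp only [Finset.mem_erase, Finset.mem_univ, and_true]
      rintro rfl
      exact lt_irrefl _ hc
    · simp only [Finset.mem_filter, Finset.mem_univ, true_and, not_lt] at hc'
      have hne : r e.1 ≠ r c := fun h => (Finset.mem_erase.1 hc).1 (hr.1 h).symm
      rw [loading_eq_zero_of_rank_lt y (lt_of_le_of_ne hc' hne), mul_zero]

theorem concentration_comm (y : Coord G r → ℝ) (i j : V) :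
    concentration y i j = concentration y j i := by
  simp only [concentration_apply]
  exact Finset.sum_congr rfl fun c _ => by ring

/-- No fill-in: a nonzero term of the sum puts both indices in the family of one vertex c, and
families are complete. -/
theorem concentration_eq_zero (hr : IsPerfectElimination G r) (y : Coord G r → ℝ) {i j : V}
    (h : s(i, j) ∉ closedEdges G) : concentration y i j = 0 := by
  rw [concentration_apply]
  refine Finset.sum_eq_zero fun c _ => ?_
  by_contra hc
  have hi : i ∈ (insert c (parents G r c) : Finset V) := by
    simpa using eq_or_mem_of_loading_ne_zero (left_ne_zero_of_mul (left_ne_zero_of_mul hc))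
  have hj : j ∈ (insert c (parents G r c) : Finset V) := by
    simpa using eq_or_mem_of_loading_ne_zero (right_ne_zero_of_mul hc)
  refine h ?_
  by_cases hij : i = j
  · exact Or.inl hij
  · exact Or.inr (hr.isClique_insert_parents c hi hj hij)

theorem toMatrix_eq_concentration (hr : IsPerfectElimination G r) (y : Coord G r → ℝ)
    (x : IncompleteMatrix G) (h : ∀ e : Coord G r, x e.edge = concentration y e.vertex e.1) :
    toMatrix G x = concentration y := by
  ext i j
  by_cases hij : s(i, j) ∈ closedEdges G
  · obtain ⟨e, he⟩ := hr.bijective_edge.2 ⟨s(i, j), hij⟩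
    have h' : s(e.vertex, e.1) = s(i, j) := congrArg Subtype.val he
    have h1 : toMatrix G x i j = x e.edge := by
      rw [he]; simp [toMatrix, hij]
    rw [h1, h]
    rcases Sym2.eq_iff.1 h' with ⟨h1, h2⟩ | ⟨h1, h2⟩
    · rw [h1, h2]
    · rw [h1, h2, concentration_comm]
  · rw [concentration_eq_zero hr y hij]
    simp [toMatrix, hij]

open MeasureTheory in
/-- The coordinates preserve Lebesgue measure. -/
theorem exists_coordinates (hr : IsPerfectElimination G r) :
    ∃ Φ : (Coord G r → ℝ) ≃ᵐ IncompleteMatrix G, MeasurePreserving Φ volume volume ∧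
      ∀ y, (∀ v, weight y v ≠ 0) → toMatrix G (Φ y) = concentration y := by
  classical
  -- Division by a zero weight gives 0, so the shear is defined and measurable everywhere; it is
  -- claimed to produce `concentration y` only where no weight vanishes.
  have hload : ∀ u v, Measurable fun y : Coord G r → ℝ => loading y u v := by
    intro u v
    simp only [loading, Matrix.of_apply]
    split_ifs <;> fun_prop
  obtain ⟨Ψ, hΨ, hΨe⟩ := exists_measurePreserving_shear (fun e : Coord G r => r e.1)
    (fun e y => ∑ c ∈ Finset.univ.filter (fun c => r c < r e.1),
        loading y e.vertex c * weight y c * loading y e.1 c)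
    (fun e => Finset.measurable_sum _ fun c _ =>
      ((hload _ _).mul (measurable_pi_apply _)).mul (hload _ _))
    (fun e y y' h => by
      refine Finset.sum_congr rfl fun c hc => ?_
      have hc' : r c < r e.1 := (Finset.mem_filter.1 hc).2
      have hyc : ∀ z, y ⟨c, z⟩ = y' ⟨c, z⟩ := fun z => h ⟨c, z⟩ hc'
      simp only [loading, weight, Matrix.of_apply, hyc])
  let ε : Coord G r ≃ closedEdges G := Equiv.ofBijective _ hr.bijective_edge
  refine ⟨Ψ.trans (MeasurableEquiv.piCongrLeft (fun _ => ℝ) ε),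
    (volume_measurePreserving_piCongrLeft (fun _ => ℝ) ε).comp hΨ, fun y hy => ?_⟩
  refine toMatrix_eq_concentration hr y _ fun e => ?_
  rw [concentration_coord hr y hy, ← hΨe]
  exact Equiv.piCongrLeft_apply_apply (fun _ => ℝ) ε (Ψ y) e

end Elimination

/-! ### The integral over the concentration cone -/

section Integral

open MeasureTheory Matrix

theorem ae_weight_ne_zero {V : Type*} [Fintype V] {G : SimpleGraph V} {r : V → ℕ}
    (v : V) :
    ∀ᵐ y : Coord G r → ℝ, weight y v ≠ 0 :=
  Measure.ae_eval_ne (α := fun _ : Coord G r => ℝ) (fun _ => volume) ⟨v, Sum.inr ()⟩ (0 : ℝ)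

variable {V : Type*} [Fintype V] [DecidableEq V] {G : SimpleGraph V} {r : V → ℕ}

theorem blockTriangular_loading (y : Coord G r → ℝ) :
    (loading y).BlockTriangular fun v => OrderDual.toDual (r v) :=
  fun _ _ h => loading_eq_zero_of_rank_lt y h

theorem det_loading (hr : IsPerfectElimination G r) (y : Coord G r → ℝ) :
    (loading y).det = 1 := by
  rw [(blockTriangular_loading y).det]
  refine Finset.prod_eq_one fun a _ => ?_
  have : (loading y).toSquareBlock (fun v => OrderDual.toDual (r v)) a = 1 := by
    ext i j
    have hij : i = j := Subtype.ext (hr.1 (OrderDual.toDual.injective (i.2.trans j.2.symm)))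
    subst hij
    simp [toSquareBlock_def]
  rw [this, det_one]

theorem posDef_concentration_iff (hr : IsPerfectElimination G r) (y : Coord G r → ℝ) :
    (concentration y).PosDef ↔ ∀ v, 0 < weight y v := by
  have hu : IsUnit (loading y) := by
    rw [isUnit_iff_isUnit_det, det_loading hr]; exact isUnit_one
  have h := hu.posDef_star_right_conjugate_iff (x := diagonal (weight y))
  rw [star_eq_conjTranspose, conjTranspose_eq_transpose_of_trivial] at h
  exact h.trans posDef_diagonal_iff

theorem inv_loading_diag (hr : IsPerfectElimination G r) (y : Coord G r → ℝ) (v : V) :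
    (loading y)⁻¹ v v = 1 ∧ ∀ u, r v < r u → (loading y)⁻¹ v u = 0 := by
  have hdet : IsUnit (loading y).det := by rw [det_loading hr]; exact isUnit_one
  let _ : Invertible (loading y) := invertibleOfIsUnitDet _ hdet
  have htri := blockTriangular_inv_of_blockTriangular (blockTriangular_loading y)
  have hzero : ∀ u, r v < r u → (loading y)⁻¹ v u = 0 := fun u hu => htri hu
  refine ⟨?_, hzero⟩
  have h1 := congrFun (congrFun (nonsing_inv_mul _ hdet) v) v
  rw [mul_apply, Finset.sum_eq_single v] at h1
  · simpa using h1
  · intro u _ huv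
    rcases lt_trichotomy (r v) (r u) with h | h | h
    · rw [hzero u h, zero_mul]
    · exact absurd (hr.1 h).symm huv
    · rw [loading_eq_zero_of_rank_lt y h, mul_zero]
  · simp

/-- The right-hand side is triangular: column v of ΣL vanishes at all vertices of larger rank, in
particular at the parents of v. These are the normal equations for the regression of v on its
parents. -/
theorem inv_concentration_mul_loading (hr : IsPerfectElimination G r) (y : Coord G r → ℝ)
    (hy : ∀ v, weight y v ≠ 0) :
    (concentration y)⁻¹ * loading y =
      ((loading y)⁻¹)ᵀ * diagonal fun v => (weight y v)⁻¹ := by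
  have hdet : IsUnit (loading y).det := by rw [det_loading hr]; exact isUnit_one
  have hinv : (concentration y)⁻¹ =
      ((loading y)⁻¹)ᵀ * (diagonal fun v => (weight y v)⁻¹) * (loading y)⁻¹ := by
    refine inv_eq_right_inv ?_
    have h1 : (loading y)ᵀ * ((loading y)⁻¹)ᵀ = 1 := by
      rw [← transpose_mul, nonsing_inv_mul _ hdet, transpose_one]
    have h2 : diagonal (weight y) * (diagonal fun v => (weight y v)⁻¹) = 1 := by
      rw [diagonal_mul_diagonal, ← diagonal_one]
      congr 1
      funext v
      exact mul_inv_cancel₀ (hy v)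
    calc concentration y *
          (((loading y)⁻¹)ᵀ * (diagonal fun v => (weight y v)⁻¹) * (loading y)⁻¹)
        = loading y * (diagonal (weight y) * (((loading y)ᵀ * ((loading y)⁻¹)ᵀ) *
            (diagonal fun v => (weight y v)⁻¹))) * (loading y)⁻¹ := by
          simp only [concentration, Matrix.mul_assoc]
      _ = 1 := by rw [h1, Matrix.one_mul, h2, Matrix.mul_one, mul_nonsing_inv _ hdet]
  rw [hinv, Matrix.mul_assoc, nonsing_inv_mul _ hdet, Matrix.mul_one]

/-- In the inverse of a concentration matrix, the conditional variance of a vertex given its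
parents is the inverse of its weight. -/
theorem det_block_inv_concentration (hr : IsPerfectElimination G r) (y : Coord G r → ℝ)
    (hy : ∀ v, 0 < weight y v) (v : V) :
    (block (concentration y)⁻¹ (insert v (parents G r v))).det * weight y v =
      (block (concentration y)⁻¹ (parents G r v)).det := by
  set S := (concentration y)⁻¹ with hS
  have hSpos : S.PosDef := ((posDef_concentration_iff hr y).2 hy).inv
  have hsym : ∀ i j, S i j = S j i := fun i j => by
    have := hSpos.isHermitian.apply i j
    simpa using this.symm
  have hy' : ∀ v, weight y v ≠ 0 := fun v => (hy v).ne'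
  have hcol : ∀ x, S x v + ∑ p : parents G r v, loading y p v * S x p =
      (loading y)⁻¹ v x * (weight y v)⁻¹ := by
    intro x
    rw [← sum_loading_mul]
    have := congrFun (congrFun (inv_concentration_mul_loading hr y hy') x) v
    rw [mul_diagonal, mul_apply] at this
    rw [transpose_apply] at this
    rw [← this]
    exact Finset.sum_congr rfl fun u _ => mul_comm _ _
  have hQ := posDef_block hSpos (parents G r v)
  -- The rows of `hcol` at the parents say that the regression coefficients are minus the loadings;
  -- the row at v will identify the residual variance with 1/ω_v.
  have hAl : block S (parents G r v) *ᵥ (fun p : parents G r v => -loading y p v) =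
      fun p : parents G r v => S p v := by
    funext p
    have h := hcol p
    rw [(inv_loading_diag hr y v).2 p (mem_parents.1 p.2).2, zero_mul] at h
    simp only [mulVec, dotProduct, block, submatrix_apply, mul_neg, Finset.sum_neg_distrib]
    rw [← eq_neg_iff_add_eq_zero] at h
    rw [h]
    exact congrArg _ (Finset.sum_congr rfl fun u _ => mul_comm _ _)
  have hinv : (block S (parents G r v))⁻¹ *ᵥ (fun p : parents G r v => S p v) =
      fun p : parents G r v => -loading y p v := by
    rw [← hAl, mulVec_mulVec, nonsing_inv_mul _ (isUnit_iff_ne_zero.2 hQ.det_pos.ne'), one_mulVec]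
  have hv := hcol v
  rw [(inv_loading_diag hr y v).1, one_mul] at hv
  rw [det_block_insert hsym self_notMem_parents hQ, hinv]
  have hd : S v v - (fun p : parents G r v => S p v) ⬝ᵥ (fun p => -loading y p v) =
      (weight y v)⁻¹ := by
    rw [← hv]
    simp only [dotProduct, mul_neg, Finset.sum_neg_distrib, sub_neg_eq_add]
    congr 1
    exact Finset.sum_congr rfl fun p _ => by rw [hsym v p, mul_comm]
  rw [hd, mul_assoc, inv_mul_cancel₀ (hy' v), mul_one]

/-- The trace is the sum of ω_v (LᵀUL)_{vv}, and column v of L only uses the coordinates of v, so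
different vertices do not interact. -/
theorem trace_concentration_mul (y : Coord G r → ℝ)
    (hy : ∀ v, weight y v ≠ 0) {U : Matrix V V ℝ} (hU : ∀ i j, U i j = U j i) :
    (concentration y * U).trace = ∑ v, (weight y v * U v v +
      2 * ((fun p => y ⟨v, Sum.inl p⟩) ⬝ᵥ fun p : parents G r v => U p v) +
      ((fun p => y ⟨v, Sum.inl p⟩) ⬝ᵥ block U (parents G r v) *ᵥ
        fun p => y ⟨v, Sum.inl p⟩) / weight y v) := by
  have h1 : (concentration y * U).trace =
      ∑ v, weight y v * ∑ i, loading y i v * ∑ j, loading y j v * U j i := by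
    have h2 : ∀ i, (concentration y * U) i i =
        ∑ v, ∑ j, weight y v * (loading y i v * (loading y j v * U j i)) := by
      intro i
      rw [mul_apply, Finset.sum_comm]
      simp only [concentration_apply, Finset.sum_mul]
      exact Finset.sum_congr rfl fun j _ => Finset.sum_congr rfl fun v _ => by ring
    simp only [trace, diag_apply, h2, Finset.mul_sum]
    exact Finset.sum_comm
  rw [h1]
  refine Finset.sum_congr rfl fun v _ => ?_
  rw [sum_loading_mul]
  simp only [sum_loading_mul y v, loading_parent, dotProduct, mulVec, block, submatrix_apply]
  have hw := hy v
  have e1 : ∑ p : parents G r v, y ⟨v, Sum.inl p⟩ / weight y v * U p v =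
      (∑ p : parents G r v, y ⟨v, Sum.inl p⟩ * U p v) / weight y v := by
    rw [Finset.sum_div]
    exact Finset.sum_congr rfl fun p _ => by ring
  have e2 : ∑ p : parents G r v, y ⟨v, Sum.inl p⟩ / weight y v *
      (U v p + ∑ q : parents G r v, y ⟨v, Sum.inl q⟩ / weight y v * U q p) =
      (∑ p : parents G r v, y ⟨v, Sum.inl p⟩ * U p v) / weight y v +
      (∑ p : parents G r v, y ⟨v, Sum.inl p⟩ *
        ∑ q : parents G r v, U p q * y ⟨v, Sum.inl q⟩) / weight y v / weight y v := by
    rw [Finset.sum_div, Finset.sum_div, Finset.sum_div, ← Finset.sum_add_distrib]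
    refine Finset.sum_congr rfl fun p _ => ?_
    have : ∑ q : parents G r v, y ⟨v, Sum.inl q⟩ / weight y v * U q p =
        (∑ q : parents G r v, U p q * y ⟨v, Sum.inl q⟩) / weight y v := by
      rw [Finset.sum_div]
      exact Finset.sum_congr rfl fun q _ => by rw [hU p q]; ring
    rw [this, hU v p]
    ring
  rw [e1, e2]
  field_simp
  ring

theorem exp_mul_exp_eq_prod_vertexFactor (s : V → ℝ) (y : Coord G r → ℝ)
    (hy : ∀ v, 0 < weight y v) {U : Matrix V V ℝ} (hU : ∀ i j, U i j = U j i) :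
    ENNReal.ofReal (Real.exp (-(concentration y * U).trace) *
        Real.exp (∑ v, s v * Real.log (weight y v))) =
      ∏ v, vertexFactor (s v) (block U (parents G r v)) (fun p => U p v) (U v v)
        fun z => y ⟨v, z⟩ := by
  have hf : ∀ v, vertexFactor (s v) (block U (parents G r v)) (fun p => U p v) (U v v)
      (fun z => y ⟨v, z⟩) = ENNReal.ofReal (Real.exp (s v * Real.log (weight y v) -
        (weight y v * U v v +
      2 * ((fun p => y ⟨v, Sum.inl p⟩) ⬝ᵥ fun p : parents G r v => U p v) +
      ((fun p => y ⟨v, Sum.inl p⟩) ⬝ᵥ block U (parents G r v) *ᵥ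
        fun p => y ⟨v, Sum.inl p⟩) / weight y v))) := fun v => if_pos (hy v)
  simp_rw [hf]
  rw [← ENNReal.ofReal_prod_of_nonneg fun v _ => (Real.exp_pos _).le, ← Real.exp_sum,
    Finset.sum_sub_distrib, ← trace_concentration_mul y (fun v => (hy v).ne') hU, ← Real.exp_add]
  congr 2
  ring

/-- If `R` is a product of powers of the weights, then the integral of `exp(-tr(ΩU)) R(Ω⁻¹)` is
a constant times a product of powers of conditional variances and of determinants of `U`. -/
theorem lintegral_concentrationCone (hr : IsPerfectElimination G r) (R : Matrix V V ℝ → ℝ)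
    (s : V → ℝ) (hs : ∀ v, 0 < s v + ((parents G r v).card : ℝ) / 2 + 1)
    (hR : ∀ (M : Matrix V V ℝ) (ω : V → ℝ), M.PosDef → (∀ v, 0 < ω v) →
      (∀ v, (block M (insert v (parents G r v))).det * ω v = (block M (parents G r v)).det) →
      R M = Real.exp (∑ v, s v * Real.log (ω v))) :
    ∃ K : ℝ≥0∞, K < ∞ ∧ ∀ U ∈ partialPosDefCone G,
      ∫⁻ Ω in concentrationCone G,
        ENNReal.ofReal (Real.exp (-(toMatrix G Ω * toMatrix G U).trace) * R (toMatrix G Ω)⁻¹) =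
      K * ENNReal.ofReal (Real.exp (∑ v,
        (-(s v + ((parents G r v).card : ℝ) / 2 + 1) *
          (Real.log (block (toMatrix G U) (insert v (parents G r v))).det -
            Real.log (block (toMatrix G U) (parents G r v)).det) -
          1 / 2 * Real.log (block (toMatrix G U) (parents G r v)).det))) := by
  classical
  refine ⟨∏ v, (ENNReal.ofReal (√Real.pi ^ (parents G r v).card) *
    ENNReal.ofReal (Real.Gamma (s v + ((parents G r v).card : ℝ) / 2 + 1))),
    ENNReal.prod_lt_top fun v _ => ENNReal.mul_lt_top ENNReal.ofReal_lt_top ENNReal.ofReal_lt_top,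
    fun U hU => ?_⟩
  obtain ⟨Φ, hΦ, hΦe⟩ := exists_coordinates hr
  have hpa : ∀ v, (block (toMatrix G U) (parents G r v)).PosDef := fun v =>
    posDef_block_of_isClique hU ((hr.isClique_insert_parents v).subset (by simp))
  have hfam : ∀ v, (block (toMatrix G U) (insert v (parents G r v))).PosDef := fun v =>
    posDef_block_of_isClique hU (hr.isClique_insert_parents v)
  have hschur : ∀ v, (block (toMatrix G U) (insert v (parents G r v))).det = _ := fun v =>
    det_block_insert (toMatrix_comm G U) self_notMem_parents (hpa v)
  have hcone : MeasurableSet {y : Coord G r → ℝ | ∀ v, 0 < weight y v} := by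
    simp only [Set.ofPred_forall]
    exact MeasurableSet.iInter fun v => measurableSet_lt measurable_const (measurable_pi_apply _)
  -- Only almost everywhere, since Φ is known to give `concentration` only off the null set where
  -- some weight is zero.
  have hpre : Φ ⁻¹' concentrationCone G =ᵐ[volume] {y : Coord G r → ℝ | ∀ v, 0 < weight y v} := by
    filter_upwards [ae_all_iff.2 fun v => ae_weight_ne_zero (G := G) (r := r) v] with y hy
    refine propext (Iff.trans ?_ (posDef_concentration_iff hr y))
    rw [← hΦe y hy]
    rfl
  rw [← hΦ.setLIntegral_comp_preimage_emb Φ.measurableEmbedding, setLIntegral_congr hpre,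
    ← lintegral_indicator hcone]
  -- `vertexFactor` is 0 for a nonpositive weight, so the product of the factors already contains
  -- the indicator of the cone.
  have hae : ∀ y : Coord G r → ℝ, {y : Coord G r → ℝ | ∀ v, 0 < weight y v}.indicator (fun y =>
        ENNReal.ofReal (Real.exp (-(toMatrix G (Φ y) * toMatrix G U).trace) *
          R (toMatrix G (Φ y))⁻¹)) y =
      ∏ v, vertexFactor (s v) (block (toMatrix G U) (parents G r v))
        (fun p => toMatrix G U p v) (toMatrix G U v v) fun z => y ⟨v, z⟩ := by
    intro y
    by_cases hpos : ∀ v, 0 < weight y v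
    · rw [Set.indicator_of_mem (by exact hpos), hΦe y fun v => (hpos v).ne',
        hR _ (weight y) ((posDef_concentration_iff hr y).2 hpos).inv hpos
          (det_block_inv_concentration hr y hpos),
        exp_mul_exp_eq_prod_vertexFactor s y hpos (toMatrix_comm G U)]
    · rw [Set.indicator_of_notMem (by exact hpos)]
      push Not at hpos
      obtain ⟨v, hv⟩ := hpos
      exact (Finset.prod_eq_zero (Finset.mem_univ v) (if_neg (not_lt.2 hv))).symm
  rw [lintegral_congr hae, ← volume_measurePreserving_piCurry.symm.lintegral_comp_emb
    (MeasurableEquiv.measurableEmbedding _)]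
  calc _ = ∫⁻ z : ∀ v : V, ((parents G r v) ⊕ Unit → ℝ), ∏ v, vertexFactor (s v)
          (block (toMatrix G U) (parents G r v))
          (fun p => toMatrix G U p v) (toMatrix G U v v) (z v) := rfl
    _ = _ := by
      rw [lintegral_pi_prod _ fun v => measurable_vertexFactor _ _ _ _,
        Real.exp_sum, ENNReal.ofReal_prod_of_nonneg fun v _ => (Real.exp_pos _).le,
        ← Finset.prod_mul_distrib]
      refine Finset.prod_congr rfl fun v _ => ?_
      have hd : 0 < toMatrix G U v v - (fun p : parents G r v => toMatrix G U p v) ⬝ᵥ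
          (block (toMatrix G U) (parents G r v))⁻¹ *ᵥ fun p => toMatrix G U p v := by
        have := (hfam v).det_pos
        rw [hschur] at this
        exact pos_of_mul_pos_right this (hpa v).det_pos.le
      rw [lintegral_vertexFactor (hpa v) _ hd (by simpa using hs v), hschur,
        Real.log_mul (hpa v).det_pos.ne' hd.ne', add_sub_cancel_left, Fintype.card_coe]

end Integral

/-! ## A criterion for (B1) and (B2) -/

section Criterion

variable {V : Type*} {G : SimpleGraph V}

theorem parents_eq_of_forall [Fintype V] {r : V → ℕ} {v : V} {Q : Finset V}
    (h : ∀ u, u ∈ Q ↔ G.Adj v u ∧ r v < r u) : parents G r v = Q := by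
  ext u
  rw [mem_parents, h]

variable [DecidableEq V] {n : ℕ}

theorem PerfectOrder.markovRatio_eq_exp (P : PerfectOrder G n) (a : Fin (n + 1) → ℝ)
    (b : Fin n → ℝ) {M : Matrix V V ℝ} (hC : ∀ j, 0 < (block M (P.clique j)).det)
    (hS : ∀ j, 0 < (block M (P.sep j)).det) :
    P.markovRatio a b M = Real.exp (∑ j, a j * Real.log (block M (P.clique j)).det -
      ∑ j, b j * Real.log (block M (P.sep j)).det) := by
  rw [markovRatio, Real.exp_sub, Real.exp_sum, Real.exp_sum]
  congr 1 <;> refine Finset.prod_congr rfl fun j _ => ?_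
  · rw [Real.rpow_def_of_pos (hC j), mul_comm]
  · rw [Real.rpow_def_of_pos (hS j), mul_comm]

theorem PerfectOrder.isClique_clique (P : PerfectOrder G n) (j : Fin (n + 1)) :
    G.IsClique (P.clique j : Set V) :=
  ((P.isMaxClique_iff _).2 ⟨j, rfl⟩).1

theorem PerfectOrder.isClique_sep (P : PerfectOrder G n) (j : Fin n) :
    G.IsClique (P.sep j : Set V) :=
  (P.isClique_clique j.succ).subset (by simp [sep, separator])

variable [Fintype V] {r : V → ℕ}

/-- Conditions (B1) and (B2) follow from two identities between linear forms in the logarithms of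
the determinants of the blocks. -/
theorem PerfectOrder.mem_typeIIParams (P : PerfectOrder G n) (hr : IsPerfectElimination G r)
    (θ : Params G) (s : V → ℝ) (hs : ∀ v, 0 < s v + ((parents G r v).card : ℝ) / 2 + 1)
    (h1 : ∀ l : Finset V → ℝ, l ∅ = 0 →
      ∑ j, (P.alpha θ j + (((P.clique j).card : ℝ) + 1) / 2) * l (P.clique j) -
        ∑ j, (P.beta θ j + (((P.sep j).card : ℝ) + 1) / 2) * l (P.sep j) =
      ∑ v, s v * (l (parents G r v) - l (insert v (parents G r v))))
    (h2 : ∀ l : Finset V → ℝ, l ∅ = 0 →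
      ∑ j, P.alpha θ j * l (P.clique j) - ∑ j, P.beta θ j * l (P.sep j) =
      ∑ v, (-(s v + ((parents G r v).card : ℝ) / 2 + 1) *
        (l (insert v (parents G r v)) - l (parents G r v)) - 1 / 2 * l (parents G r v))) :
    θ ∈ P.typeIIParams := by
  -- The last vertex has no parents; the empty block has determinant 1, which is why the identities
  -- are only required for `l ∅ = 0`.
  have hempty : ∀ M : Matrix V V ℝ, Real.log (block M ∅).det = 0 := fun M => by
    rw [Matrix.det_isEmpty, Real.log_one]
  obtain ⟨K, hK, hint⟩ := lintegral_concentrationCone hr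
    (fun M => P.markovRatio (P.alpha θ) (P.beta θ) M *
      P.markovRatio (fun j => (((P.clique j).card : ℝ) + 1) / 2)
        (fun j => (((P.sep j).card : ℝ) + 1) / 2) M) s hs (by
    intro M ω hM hω hdet
    have hpos : ∀ A : Finset V, 0 < (block M A).det := fun A => (posDef_block hM A).det_pos
    rw [P.markovRatio_eq_exp _ _ (fun j => hpos _) fun j => hpos _,
      P.markovRatio_eq_exp _ _ (fun j => hpos _) fun j => hpos _, ← Real.exp_add]
    have hlog : ∀ v, Real.log (ω v) = Real.log (block M (parents G r v)).det -
        Real.log (block M (insert v (parents G r v))).det := fun v => by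
      rw [← hdet v, Real.log_mul (hpos _).ne' (hω v).ne', add_sub_cancel_left]
    simp only [hlog]
    rw [← h1 (fun A => Real.log (block M A).det) (hempty M)]
    simp only [add_mul, Finset.sum_add_distrib]
    congr 1
    ring)
  have hI : ∀ U ∈ partialPosDefCone G, P.typeIIIntegral θ U = K *
      ENNReal.ofReal (P.markovRatio (P.alpha θ) (P.beta θ) (toMatrix G U)) := by
    intro U hU
    rw [P.markovRatio_eq_exp _ _
      (fun j => (posDef_block_of_isClique hU (P.isClique_clique j)).det_pos)
      fun j => (posDef_block_of_isClique hU (P.isClique_sep j)).det_pos,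
      h2 (fun A => Real.log (block (toMatrix G U) A).det) (hempty _), ← hint U hU]
    simp only [typeIIIntegral, typeIIDensity, mul_assoc]
  have hpos : ∀ U ∈ partialPosDefCone G,
      0 < P.markovRatio (P.alpha θ) (P.beta θ) (toMatrix G U) := by
    intro U hU
    rw [P.markovRatio_eq_exp _ _
      (fun j => (posDef_block_of_isClique hU (P.isClique_clique j)).det_pos)
      fun j => (posDef_block_of_isClique hU (P.isClique_sep j)).det_pos]
    exact Real.exp_pos _
  refine ⟨fun U hU => ?_, K, fun U hU => ?_⟩
  · rw [hI U hU]
    exact ENNReal.mul_lt_top hK ENNReal.ofReal_lt_top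
  · rw [hI U hU]
    exact ENNReal.mul_div_cancel_right (ENNReal.ofReal_pos.2 (hpos U hU)).ne' ENNReal.ofReal_ne_top

end Criterion

/-! ## The families of multi-parameters on the two graphs -/

section Families

/-- With labels as ranks, `parents` gives the parent sets of `dagSix`, whose arrows go from larger
to smaller labels. -/
theorem isPerfectElimination_six : IsPerfectElimination graphSix Fin.val :=
  ⟨Fin.val_injective, by decide +kernel⟩

/-- Ranks on the graph on six vertices for which the vertex `4` is the last one. -/
def rankSix : Fin 6 → ℕ := ![2, 1, 0, 5, 4, 3]

theorem isPerfectElimination_rankSix : IsPerfectElimination graphSix rankSix :=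
  ⟨by decide, by decide +kernel⟩

theorem isPerfectElimination_eight : IsPerfectElimination graphEight Fin.val :=
  ⟨Fin.val_injective, by decide +kernel⟩

/-- Ranks on the graph on eight vertices for which the vertex `6` is the last one. -/
def rankEight : Fin 8 → ℕ := ![2, 3, 0, 1, 6, 7, 4, 5]

theorem isPerfectElimination_rankEight : IsPerfectElimination graphEight rankEight :=
  ⟨by decide, by decide +kernel⟩

theorem parents_six : parents graphSix Fin.val = ![{3}, {5}, {4, 5}, {4, 5}, {5}, ∅] := by
  funext v
  refine parents_eq_of_forall fun u => ?_
  revert u v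
  decide

theorem parents_rankSix : parents graphSix rankSix = ![{3}, {5}, {4, 5}, ∅, {3}, {3, 4}] := by
  funext v
  refine parents_eq_of_forall fun u => ?_
  revert u v
  decide

theorem parents_eight : parents graphEight Fin.val =
    ![{4, 5}, {4, 5}, {6, 7}, {6, 7}, {5}, {7}, {7}, ∅] := by
  funext v
  refine parents_eq_of_forall fun u => ?_
  revert u v
  decide

theorem parents_rankEight : parents graphEight rankEight =
    ![{4, 5}, {4, 5}, {6, 7}, {6, 7}, {5}, ∅, {7}, {5}] := by
  funext v
  refine parents_eq_of_forall fun u => ?_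
  revert u v
  decide

theorem orderSix_clique : orderSix.clique = ![{2, 4, 5}, {3, 4, 5}, {1, 5}, {0, 3}] := rfl

theorem orderSix_sep : orderSix.sep = ![{4, 5}, {5}, {3}] := by
  funext j; revert j; decide

theorem orderEight_clique : orderEight.clique =
    ![{3, 6, 7}, {2, 6, 7}, {5, 7}, {1, 4, 5}, {0, 4, 5}] := rfl

theorem orderEight_sep : orderEight.sep = ![{6, 7}, {7}, {5}, {4, 5}] := by
  funext j; revert j; decide

end Families

/-! ### Exponent matching on the two graphs -/

section Families

theorem familySix_subset : familySix ⊆ orderSix.typeIIParams := by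
  rintro θ ⟨hα, h1, h2, h3⟩
  have a0 := hα 0
  have a1 := hα 1
  have a2 := hα 2
  have a3 := hα 3
  -- The exponents are forced: families that are cliques give the first four, then the families {5,
  -- 6} and {6} (in labels) give the last two. The gamma parameters become exactly the negatives of
  -- the left-hand sides of the inequalities of the family. The coefficient of {4} is left over and
  -- gives the equation.
  refine orderSix.mem_typeIIParams isPerfectElimination_six θ
    ![-(orderSix.alpha θ 3 + 3 / 2), -(orderSix.alpha θ 2 + 3 / 2), -(orderSix.alpha θ 0 + 2),
      -(orderSix.alpha θ 1 + 2), -(orderSix.alpha θ 0 + orderSix.alpha θ 1 - orderSix.beta θ 0 + 5 / 2),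
      -(orderSix.alpha θ 0 + orderSix.alpha θ 1 + orderSix.alpha θ 2
        - orderSix.beta θ 0 - orderSix.beta θ 1 + 3)] ?_ ?_ ?_
  · rw [parents_six]
    intro v
    fin_cases v <;> simp <;> linarith
  · intro l hl
    rw [parents_six, orderSix_clique, orderSix_sep]
    simp [Fin.sum_univ_four, Fin.sum_univ_three, Fin.sum_univ_six, hl]
    linear_combination l {3} * h3
  · intro l hl
    rw [parents_six, orderSix_clique, orderSix_sep]
    simp [Fin.sum_univ_four, Fin.sum_univ_three, Fin.sum_univ_six, hl]
    linear_combination l {3} * h3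

/-- With vertex 4 as the last one, {4} is a family and β({4}) is free; {5, 6} and {6} are now only
parent sets and give two equations. This covers the perfect orders whose first separator is {4}. -/
theorem mem_typeIIParams_six_of_root {θ : Params graphSix} (hα : ∀ j, orderSix.alpha θ j < 0)
    (h0 : orderSix.alpha θ 1 + 1 / 2 < 0)
    (h1 : orderSix.alpha θ 1 + orderSix.alpha θ 3 - orderSix.beta θ 2 + 3 / 2 < 0)
    (h2 : orderSix.alpha θ 0 - orderSix.beta θ 0 + 1 / 2 = 0)
    (h3 : orderSix.alpha θ 2 - orderSix.beta θ 1 + 1 / 2 = 0) :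
    θ ∈ orderSix.typeIIParams := by
  have a0 := hα 0
  have a1 := hα 1
  have a2 := hα 2
  have a3 := hα 3
  have e : ({5, 3, 4} : Finset (Fin 6)) = {3, 4, 5} := by decide
  have e' : ({4, 3} : Finset (Fin 6)) = {3, 4} := by decide
  -- The last two exponents agree because {4, 5} (in labels) is a family and a parent set but
  -- neither a clique nor a separator, so its determinant must cancel.
  refine orderSix.mem_typeIIParams isPerfectElimination_rankSix θ
    ![-(orderSix.alpha θ 3 + 3 / 2), -(orderSix.alpha θ 2 + 3 / 2), -(orderSix.alpha θ 0 + 2),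
      -(orderSix.alpha θ 1 + orderSix.alpha θ 3 - orderSix.beta θ 2 + 5 / 2),
      -(orderSix.alpha θ 1 + 2), -(orderSix.alpha θ 1 + 2)] ?_ ?_ ?_
  · rw [parents_rankSix]
    intro v
    fin_cases v <;> simp <;> linarith
  · intro l hl
    rw [parents_rankSix, orderSix_clique, orderSix_sep]
    simp [Fin.sum_univ_four, Fin.sum_univ_three, Fin.sum_univ_six, hl, e, e']
    linear_combination l {4, 5} * h2 + l {5} * h3
  · intro l hl
    rw [parents_rankSix, orderSix_clique, orderSix_sep]
    simp [Fin.sum_univ_four, Fin.sum_univ_three, Fin.sum_univ_six, hl, e, e']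
    linear_combination l {4, 5} * h2 + l {5} * h3

/-- Since {5, 6} is the family of vertex 5, only the separator {6} obstructs. The single equation
`h4` is the sum of the two equations in `familyEight`; the weaker form is needed for perfect orders
that assign the two cliques to {6} and {5, 6} the other way round. -/
theorem mem_typeIIParams_eight {θ : Params graphEight} (hα : ∀ j, orderEight.alpha θ j < 0)
    (h1 : orderEight.alpha θ 0 + orderEight.alpha θ 1 - orderEight.beta θ 0 + 1 < 0)
    (h2 : orderEight.alpha θ 0 + orderEight.alpha θ 1 + orderEight.alpha θ 2
      - orderEight.beta θ 0 - orderEight.beta θ 1 + 2 < 0)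
    (h3 : orderEight.alpha θ 3 + orderEight.alpha θ 4 - orderEight.beta θ 3 + 1 < 0)
    (h4 : orderEight.alpha θ 3 + orderEight.alpha θ 4 - orderEight.beta θ 2
      - orderEight.beta θ 3 + 3 / 2 = 0) :
    θ ∈ orderEight.typeIIParams := by
  have a0 := hα 0
  have a1 := hα 1
  have a2 := hα 2
  have a3 := hα 3
  have a4 := hα 4
  refine orderEight.mem_typeIIParams isPerfectElimination_eight θ
    ![-(orderEight.alpha θ 4 + 2), -(orderEight.alpha θ 3 + 2), -(orderEight.alpha θ 1 + 2),
      -(orderEight.alpha θ 0 + 2),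
      -(orderEight.alpha θ 3 + orderEight.alpha θ 4 - orderEight.beta θ 3 + 5 / 2),
      -(orderEight.alpha θ 2 + 3 / 2),
      -(orderEight.alpha θ 0 + orderEight.alpha θ 1 - orderEight.beta θ 0 + 5 / 2),
      -(orderEight.alpha θ 0 + orderEight.alpha θ 1 + orderEight.alpha θ 2
        - orderEight.beta θ 0 - orderEight.beta θ 1 + 3)] ?_ ?_ ?_
  · rw [parents_eight]
    intro v
    fin_cases v <;> simp <;> linarith
  · intro l hl
    rw [parents_eight, orderEight_clique, orderEight_sep]
    simp [Fin.sum_univ_five, Fin.sum_univ_four, Fin.sum_univ_eight, hl]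
    linear_combination l {5} * h4
  · intro l hl
    rw [parents_eight, orderEight_clique, orderEight_sep]
    simp [Fin.sum_univ_five, Fin.sum_univ_four, Fin.sum_univ_eight, hl]
    linear_combination l {5} * h4

/-- The mirror image: reversing the arrow between 6 and 8 exchanges the roles of the two ends of the
graph, and the equation now comes from {8}. -/
theorem mem_typeIIParams_eight_of_root {θ : Params graphEight}
    (hα : ∀ j, orderEight.alpha θ j < 0)
    (h1 : orderEight.alpha θ 3 + orderEight.alpha θ 4 - orderEight.beta θ 3 + 1 < 0)
    (h2 : orderEight.alpha θ 3 + orderEight.alpha θ 4 + orderEight.alpha θ 2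
      - orderEight.beta θ 3 - orderEight.beta θ 2 + 2 < 0)
    (h3 : orderEight.alpha θ 0 + orderEight.alpha θ 1 - orderEight.beta θ 0 + 1 < 0)
    (h4 : orderEight.alpha θ 0 + orderEight.alpha θ 1 - orderEight.beta θ 1
      - orderEight.beta θ 0 + 3 / 2 = 0) :
    θ ∈ orderEight.typeIIParams := by
  have a0 := hα 0
  have a1 := hα 1
  have a2 := hα 2
  have a3 := hα 3
  have a4 := hα 4
  have e : ({7, 5} : Finset (Fin 8)) = {5, 7} := by decide
  refine orderEight.mem_typeIIParams isPerfectElimination_rankEight θ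
    ![-(orderEight.alpha θ 4 + 2), -(orderEight.alpha θ 3 + 2), -(orderEight.alpha θ 1 + 2),
      -(orderEight.alpha θ 0 + 2),
      -(orderEight.alpha θ 3 + orderEight.alpha θ 4 - orderEight.beta θ 3 + 5 / 2),
      -(orderEight.alpha θ 3 + orderEight.alpha θ 4 + orderEight.alpha θ 2
        - orderEight.beta θ 3 - orderEight.beta θ 2 + 3),
      -(orderEight.alpha θ 0 + orderEight.alpha θ 1 - orderEight.beta θ 0 + 5 / 2),
      -(orderEight.alpha θ 2 + 3 / 2)] ?_ ?_ ?_
  · rw [parents_rankEight]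
    intro v
    fin_cases v <;> simp <;> linarith
  · intro l hl
    rw [parents_rankEight, orderEight_clique, orderEight_sep]
    simp [Fin.sum_univ_five, Fin.sum_univ_four, Fin.sum_univ_eight, hl, e]
    linear_combination l {7} * h4
  · intro l hl
    rw [parents_rankEight, orderEight_clique, orderEight_sep]
    simp [Fin.sum_univ_five, Fin.sum_univ_four, Fin.sum_univ_eight, hl, e]
    linear_combination l {7} * h4

theorem familyEight_subset : familyEight ⊆ orderEight.typeIIParams := by
  rintro θ ⟨hα, h1, h2, h3, h4, h5⟩
  exact mem_typeIIParams_eight hα h1 h2 h3 (by linarith)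

end Families

/-! ## Comparison of perfect orders -/

section Comparison

variable {V : Type*} [DecidableEq V] {G : SimpleGraph V}

theorem PerfectOrder.natCard_cliques {n : ℕ} (P : PerfectOrder G n) :
    Nat.card (Cliques G) = n + 1 := by
  let f : Fin (n + 1) → Cliques G := fun j => ⟨P.clique j, (P.isMaxClique_iff _).2 ⟨j, rfl⟩⟩
  have hf : Function.Bijective f := by
    refine ⟨fun i j h => P.injective (congrArg Subtype.val h), fun ⟨C, hC⟩ => ?_⟩
    obtain ⟨j, hj⟩ := (P.isMaxClique_iff C).1 hC
    exact ⟨j, Subtype.ext hj⟩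
  rw [← Nat.card_congr (Equiv.ofBijective f hf), Nat.card_fin]

theorem PerfectOrder.length_unique {m n : ℕ} (P : PerfectOrder G m) (Q : PerfectOrder G n) :
    m = n := by
  have := P.natCard_cliques.symm.trans Q.natCard_cliques
  omega

variable {n : ℕ}

theorem PerfectOrder.exists_reindex (P Q : PerfectOrder G n) :
    ∃ σ : Fin (n + 1) → Fin (n + 1), Function.Injective σ ∧
      P.clique = Q.clique ∘ σ := by
  have h : ∀ j, ∃ k, Q.clique k = P.clique j := fun j =>
    (Q.isMaxClique_iff _).1 ((P.isMaxClique_iff _).2 ⟨j, rfl⟩)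
  choose σ hσ using h
  refine ⟨σ, fun i j hij => P.injective ?_, funext fun j => (hσ j).symm⟩
  rw [← hσ i, ← hσ j, hij]

theorem PerfectOrder.alpha_eq {P Q : PerfectOrder G n} (θ : Params G) {i j : Fin (n + 1)}
    (h : P.clique i = Q.clique j) : P.alpha θ i = Q.alpha θ j :=
  congrArg θ.1 (Subtype.ext h)

theorem PerfectOrder.beta_eq {P Q : PerfectOrder G n} (θ : Params G) {i j : Fin n}
    (h : P.sep i = Q.sep j) : P.beta θ i = Q.beta θ j :=
  congrArg θ.2 (Subtype.ext h)

/-- The conditions that define `B_P`, for a perfect order `P` in which every separator `S` occurs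
once. They are expressed in the enumeration of another perfect order `Q`: the first clique of `P`
has the index `ρ`, the first separator of `P` has the index `t`, and the separator with the index
`i` belongs to the clique with the index `κ i`. -/
def PerfectOrder.RootedConditions (Q : PerfectOrder G n) (δ : ℝ) (ρ : Fin (n + 1))
    (κ : Fin n → Fin (n + 1)) (t : Fin n) (θ : Params G) : Prop :=
  (∀ i, i ≠ t → Q.alpha θ (κ i) + (((Q.clique (κ i)).card : ℝ) - (Q.sep i).card) / 2
    - Q.beta θ i = 0) ∧
  (∀ i, 0 < -Q.alpha θ (κ i) - (((Q.clique (κ i)).card : ℝ) - (Q.sep i).card - 1) / 2) ∧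
  0 < -Q.alpha θ ρ - (((Q.clique ρ).card : ℝ) - (Q.sep t).card - 1) / 2 ∧
  (((Q.sep t).card : ℝ) - 1) / 2 <
    -Q.alpha θ ρ - (((Q.clique ρ).card : ℝ) - (Q.sep t).card + δ) / 2
      - (Q.alpha θ (κ t) + (((Q.clique (κ t)).card : ℝ) - (Q.sep t).card) / 2 - Q.beta θ t)

/-- When the separators are distinct, every J(P, S) is a singleton and ν(S) = 1. Then B_P remembers
only the first clique, the first separator and the clique attached to each separator, which makes
the list of cases finite and explicit. -/
theorem PerfectOrder.mem_typeIISet_iff {P Q : PerfectOrder G (n + 1)} (δ : ℝ)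
    {σ : Fin (n + 1 + 1) → Fin (n + 1 + 1)} {τ : Fin (n + 1) → Fin (n + 1)}
    {κ : Fin (n + 1) → Fin (n + 1 + 1)} (hQ : Function.Injective Q.sep)
    (hσ : ∀ j, P.clique j = Q.clique (σ j))
    (hτ : ∀ i, P.sep i = Q.sep (τ i)) (hinj : Function.Injective τ)
    (hκ : ∀ i, σ i.succ = κ (τ i)) (θ : Params G) :
    θ ∈ P.typeIISet δ ↔ Q.RootedConditions δ (σ 0) κ (τ 0) θ := by
  have hP : Function.Injective P.sep := fun i j hij => by
    rw [hτ, hτ] at hij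
    exact hinj (hQ hij)
  have hind : ∀ i, P.indices (P.sep i) = {i} := fun i => by
    ext j
    simp [indices, hP.eq_iff]
  have hsurj := Finite.surjective_of_injective hinj
  have hα : ∀ i, P.alpha θ i = Q.alpha θ (σ i) := fun i => alpha_eq θ (hσ i)
  have hβ : ∀ i, P.beta θ i = Q.beta θ (τ i) := fun i => beta_eq θ (hτ i)
  simp only [typeIISet, RootedConditions, Set.mem_ofPred_eq, hind, Finset.sum_singleton,
    Finset.card_singleton, Nat.cast_one, one_mul]
  simp only [hα, hβ, hσ, hτ, hκ, ne_eq, hQ.eq_iff]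
  constructor
  · rintro ⟨h1, h2, h3⟩
    refine ⟨fun t ht => ?_, fun t => ?_, h3⟩ <;> obtain ⟨i, rfl⟩ := hsurj t
    · exact h1 i ht
    · exact h2 i
  · rintro ⟨h1, h2, h3⟩
    exact ⟨fun i => h1 (τ i), fun i => h2 (τ i), h3⟩

end Comparison

/-! ### Enumeration of the perfect orders -/

section Enumeration

/-- The perfect orders of the cliques of the graph on six vertices: the first clique, the clique
that belongs to each separator, and the first separator. -/
def rootedOrdersSix : List (Fin 4 × (Fin 3 → Fin 4) × Fin 3) :=
  [(0, ![1, 2, 3], 0), (0, ![1, 2, 3], 1), (1, ![0, 2, 3], 0), (1, ![0, 2, 3], 1),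
    (1, ![0, 2, 3], 2), (2, ![1, 0, 3], 1), (2, ![0, 1, 3], 1), (3, ![0, 2, 1], 2)]

/-- The index of a separator of the graph on six vertices. -/
def sepIndexSix (S : Finset (Fin 6)) : Fin 3 :=
  if S = {4, 5} then 0 else if S = {5} then 1 else 2

/-- All repetition-free index sequences are tested. The first conclusion also justifies the default
value of `sepIndexSix`: a set other than the three separators would violate it. -/
theorem enumeration_six : ∀ a b c d : Fin 4, a ≠ b → a ≠ c → b ≠ c → a ≠ d → b ≠ d → c ≠ d →
    (∀ j : Fin 3, ∃ i : Fin 4, i ≤ j.castSucc ∧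
      separator (cliquesSix ∘ ![a, b, c, d]) j ⊆ cliquesSix (![a, b, c, d] i)) →
    (∀ j, separator (cliquesSix ∘ ![a, b, c, d]) j =
      separator cliquesSix (sepIndexSix (separator (cliquesSix ∘ ![a, b, c, d]) j))) ∧
    (∀ i j, sepIndexSix (separator (cliquesSix ∘ ![a, b, c, d]) i) =
      sepIndexSix (separator (cliquesSix ∘ ![a, b, c, d]) j) → i = j) ∧
    ∃ x ∈ rootedOrdersSix, x.1 = ![a, b, c, d] 0 ∧
      x.2.2 = sepIndexSix (separator (cliquesSix ∘ ![a, b, c, d]) 0) ∧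
      ∀ j : Fin 3, ![a, b, c, d] j.succ =
        x.2.1 (sepIndexSix (separator (cliquesSix ∘ ![a, b, c, d]) j)) := by
  decide +kernel

/-- The perfect orders of the cliques of the graph on eight vertices: the first clique, the clique
that belongs to each separator, and the first separator. -/
def rootedOrdersEight : List (Fin 5 × (Fin 4 → Fin 5) × Fin 4) :=
  [(0, ![1, 2, 3, 4], 0), (0, ![1, 2, 3, 4], 1), (0, ![1, 2, 4, 3], 0), (0, ![1, 2, 4, 3], 1),
    (1, ![0, 2, 3, 4], 0), (1, ![0, 2, 3, 4], 1), (1, ![0, 2, 4, 3], 0), (1, ![0, 2, 4, 3], 1),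
    (2, ![1, 0, 3, 4], 1), (2, ![1, 0, 3, 4], 2), (2, ![1, 0, 4, 3], 1), (2, ![1, 0, 4, 3], 2),
    (2, ![0, 1, 3, 4], 1), (2, ![0, 1, 3, 4], 2), (2, ![0, 1, 4, 3], 1), (2, ![0, 1, 4, 3], 2),
    (3, ![1, 0, 2, 4], 2), (3, ![1, 0, 2, 4], 3), (3, ![0, 1, 2, 4], 2), (3, ![0, 1, 2, 4], 3),
    (4, ![1, 0, 2, 3], 2), (4, ![1, 0, 2, 3], 3), (4, ![0, 1, 2, 3], 2), (4, ![0, 1, 2, 3], 3)]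

/-- The index of a separator of the graph on eight vertices. -/
def sepIndexEight (S : Finset (Fin 8)) : Fin 4 :=
  if S = {6, 7} then 0 else if S = {7} then 1 else if S = {5} then 2 else 3

theorem enumeration_eight : ∀ a b c d e : Fin 5, a ≠ b → a ≠ c → b ≠ c → a ≠ d → b ≠ d → c ≠ d →
    a ≠ e → b ≠ e → c ≠ e → d ≠ e →
    (∀ j : Fin 4, ∃ i : Fin 5, i ≤ j.castSucc ∧
      separator (cliquesEight ∘ ![a, b, c, d, e]) j ⊆ cliquesEight (![a, b, c, d, e] i)) →
    (∀ j, separator (cliquesEight ∘ ![a, b, c, d, e]) j =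
      separator cliquesEight (sepIndexEight (separator (cliquesEight ∘ ![a, b, c, d, e]) j))) ∧
    (∀ i j, sepIndexEight (separator (cliquesEight ∘ ![a, b, c, d, e]) i) =
      sepIndexEight (separator (cliquesEight ∘ ![a, b, c, d, e]) j) → i = j) ∧
    ∃ x ∈ rootedOrdersEight, x.1 = ![a, b, c, d, e] 0 ∧
      x.2.2 = sepIndexEight (separator (cliquesEight ∘ ![a, b, c, d, e]) 0) ∧
      ∀ j : Fin 4, ![a, b, c, d, e] j.succ =
        x.2.1 (sepIndexEight (separator (cliquesEight ∘ ![a, b, c, d, e]) j)) := by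
  decide +kernel

theorem PerfectOrder.exists_rooted_six (P : PerfectOrder graphSix 3) :
    ∃ (σ : Fin 4 → Fin 4) (τ : Fin 3 → Fin 3), (∀ j, P.clique j = orderSix.clique (σ j)) ∧
      (∀ i, P.sep i = orderSix.sep (τ i)) ∧ Function.Injective τ ∧
      ∃ κ, (σ 0, κ, τ 0) ∈ rootedOrdersSix ∧ ∀ i, σ i.succ = κ (τ i) := by
  obtain ⟨σ, hσ, hP⟩ := P.exists_reindex orderSix
  have h4 : ![σ 0, σ 1, σ 2, σ 3] = σ := by funext i; fin_cases i <;> rfl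
  have hne : ∀ i j, i ≠ j → σ i ≠ σ j := fun i j h h' => h (hσ h')
  have hrip := P.runningIntersection
  have key := enumeration_six (σ 0) (σ 1) (σ 2) (σ 3) (hne _ _ (by decide))
    (hne _ _ (by decide)) (hne _ _ (by decide)) (hne _ _ (by decide)) (hne _ _ (by decide))
    (hne _ _ (by decide))
  rw [h4] at key
  rw [hP] at hrip
  obtain ⟨h1, h2, ⟨ρ, κ, t⟩, hx, rfl, rfl, h5⟩ := key hrip
  refine ⟨σ, fun j => sepIndexSix (separator (cliquesSix ∘ σ) j), fun j => congrFun hP j,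
    fun i => ?_, fun i j => h2 i j, κ, hx, h5⟩
  rw [PerfectOrder.sep, hP]
  exact h1 i

theorem PerfectOrder.exists_rooted_eight (P : PerfectOrder graphEight 4) :
    ∃ (σ : Fin 5 → Fin 5) (τ : Fin 4 → Fin 4), (∀ j, P.clique j = orderEight.clique (σ j)) ∧
      (∀ i, P.sep i = orderEight.sep (τ i)) ∧ Function.Injective τ ∧
      ∃ κ, (σ 0, κ, τ 0) ∈ rootedOrdersEight ∧ ∀ i, σ i.succ = κ (τ i) := by
  obtain ⟨σ, hσ, hP⟩ := P.exists_reindex orderEight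
  have h5 : ![σ 0, σ 1, σ 2, σ 3, σ 4] = σ := by funext i; fin_cases i <;> rfl
  have hne : ∀ i j, i ≠ j → σ i ≠ σ j := fun i j h h' => h (hσ h')
  have hrip := P.runningIntersection
  have key := enumeration_eight (σ 0) (σ 1) (σ 2) (σ 3) (σ 4) (hne _ _ (by decide))
    (hne _ _ (by decide)) (hne _ _ (by decide)) (hne _ _ (by decide)) (hne _ _ (by decide))
    (hne _ _ (by decide)) (hne _ _ (by decide)) (hne _ _ (by decide)) (hne _ _ (by decide))
    (hne _ _ (by decide))
  rw [h5] at key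
  rw [hP] at hrip
  obtain ⟨h1, h2, ⟨ρ, κ, t⟩, hx, rfl, rfl, h6⟩ := key hrip
  refine ⟨σ, fun j => sepIndexEight (separator (cliquesEight ∘ σ) j), fun j => congrFun hP j,
    fun i => ?_, fun i j => h2 i j, κ, hx, h6⟩
  rw [PerfectOrder.sep, hP]
  exact h1 i

theorem injective_orderSix_sep : Function.Injective orderSix.sep := by
  rw [orderSix_sep]; decide

theorem injective_orderEight_sep : Function.Injective orderEight.sep := by
  rw [orderEight_sep]; decide

theorem card_clique_six (j : Fin 4) : ((orderSix.clique j).card : ℝ) = ![3, 3, 2, 2] j := by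
  fin_cases j <;> simp [orderSix_clique]

theorem card_sep_six (j : Fin 3) : ((orderSix.sep j).card : ℝ) = ![2, 1, 1] j := by
  fin_cases j <;> simp [orderSix_sep]

theorem card_clique_eight (j : Fin 5) :
    ((orderEight.clique j).card : ℝ) = ![3, 3, 2, 3, 3] j := by
  fin_cases j <;> simp [orderEight_clique]

theorem card_sep_eight (j : Fin 4) : ((orderEight.sep j).card : ℝ) = ![2, 1, 1, 2] j := by
  fin_cases j <;> simp [orderEight_sep]

theorem RootedConditions.mem_typeIIParams_six {δ : ℝ} (hδ : 0 ≤ δ)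
    {x : Fin 4 × (Fin 3 → Fin 4) × Fin 3} (hx : x ∈ rootedOrdersSix) {θ : Params graphSix}
    (h : orderSix.RootedConditions δ x.1 x.2.1 x.2.2 θ) : θ ∈ orderSix.typeIIParams := by
  obtain ⟨h1, h2, h3, h4⟩ := h
  simp only [card_clique_six, card_sep_six] at h1 h2 h3 h4
  have e0 := h1 0
  have e1 := h1 1
  have e2 := h1 2
  have p0 := h2 0
  have p1 := h2 1
  have p2 := h2 2
  clear h1 h2
  simp only [rootedOrdersSix, List.mem_cons, List.not_mem_nil, or_false] at hx
  rcases hx with rfl | rfl | rfl | rfl | rfl | rfl | rfl | rfl <;>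
    simp at e0 e1 e2 p0 p1 p2 h3 h4 <;>
    -- If {4} is not the first separator, condition (a) supplies the equation of `familySix`;
    -- otherwise it supplies the two equations at {5, 6} and {6}, and the order rooted at vertex 4
    -- applies. Condition (c) is used through δ ≥ 0.
    first
    | have h : orderSix.alpha θ 3 - orderSix.beta θ 2 + 1 / 2 = 0 := by linarith
      exact familySix_subset ⟨fun j => by fin_cases j <;> simp <;> linarith, by linarith,
        by linarith, h⟩
    | exact mem_typeIIParams_six_of_root (fun j => by fin_cases j <;> simp <;> linarith)
        (by linarith) (by linarith) (by linarith) (by linarith)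

set_option maxHeartbeats 2000000 in
theorem RootedConditions.mem_typeIIParams_eight {δ : ℝ} (hδ : 0 ≤ δ)
    {x : Fin 5 × (Fin 4 → Fin 5) × Fin 4} (hx : x ∈ rootedOrdersEight) {θ : Params graphEight}
    (h : orderEight.RootedConditions δ x.1 x.2.1 x.2.2 θ) : θ ∈ orderEight.typeIIParams := by
  obtain ⟨h1, h2, h3, h4⟩ := h
  simp only [card_clique_eight, card_sep_eight] at h1 h2 h3 h4
  have e0 := h1 0
  have e1 := h1 1
  have e2 := h1 2
  have e3 := h1 3
  have p0 := h2 0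
  have p1 := h2 1
  have p2 := h2 2
  have p3 := h2 3
  clear h1 h2
  simp only [rootedOrdersEight, List.mem_cons, List.not_mem_nil, or_false] at hx
  rcases hx with rfl | rfl | rfl | rfl | rfl | rfl | rfl | rfl | rfl | rfl | rfl | rfl | rfl | rfl |
      rfl | rfl | rfl | rfl | rfl | rfl | rfl | rfl | rfl | rfl <;>
    simp at e0 e1 e2 e3 p0 p1 p2 p3 h3 h4 <;>
    -- The first alternative serves the orders whose first separator is {7, 8} or {8}: adding the
    -- equations (a) at {6} and {5, 6} gives `h`. The others are handled by the mirror image.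
    first
    | have h : orderEight.alpha θ 3 + orderEight.alpha θ 4 - orderEight.beta θ 2
        - orderEight.beta θ 3 + 3 / 2 = 0 := by linarith
      exact LetacMassam.mem_typeIIParams_eight
        (fun j => by fin_cases j <;> simp <;> linarith) (by linarith) (by linarith) (by linarith) h
    | exact mem_typeIIParams_eight_of_root
        (fun j => by fin_cases j <;> simp <;> linarith) (by linarith) (by linarith) (by linarith)
        (by linarith)

end Enumeration

/-! ## The two graphs -/

section TwoGraphs

/-- On an induced cycle, the vertex of least rank has two cycle neighbours of larger rank, which
must be adjacent. Then 2 = ±1 modulo the length, impossible for length at least 4. -/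
theorem IsPerfectElimination.decomposable {V : Type*} {G : SimpleGraph V} {r : V → ℕ}
    (hr : IsPerfectElimination G r) : Decomposable G := by
  rintro n hn ⟨f⟩
  obtain ⟨m, rfl⟩ : ∃ m, n = m + 2 + 2 := ⟨n - 4, by omega⟩
  obtain ⟨i, -, hi⟩ := Finset.exists_min_image Finset.univ (fun i => r (f i)) ⟨0, Finset.mem_univ _⟩
  have hlt : ∀ j, j ≠ i → r (f i) < r (f j) := fun j hj =>
    lt_of_le_of_ne (hi j (Finset.mem_univ _)) fun h => hj (f.injective (hr.1 h)).symm
  have h1 : (1 : Fin (m + 2 + 2)) ≠ 0 := by simp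
  have h2 : (1 + 1 : Fin (m + 2 + 2)) ≠ 0 := by
    simp [Fin.ext_iff, Fin.val_add, Nat.mod_eq_of_lt (show 2 < m + 2 + 2 by omega)]
  have h3 : (1 + 1 + 1 : Fin (m + 2 + 2)) ≠ 0 := by
    simp [Fin.ext_iff, Fin.val_add, Nat.mod_eq_of_lt (show 3 < m + 2 + 2 by omega)]
  have hadj1 : (SimpleGraph.cycleGraph (m + 2 + 2)).Adj i (i + 1) :=
    SimpleGraph.cycleGraph_adj.2 (Or.inr (by abel))
  have hadj2 : (SimpleGraph.cycleGraph (m + 2 + 2)).Adj i (i - 1) :=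
    SimpleGraph.cycleGraph_adj.2 (Or.inl (by abel))
  have hne : i + 1 ≠ i - 1 := fun h => h2 (by
    have : i + 1 - (i - 1) = 0 := sub_eq_zero.2 h
    rw [← this]; abel)
  have hadj := hr.2 (f i) (f (i + 1)) (f (i - 1)) (f.map_adj_iff.2 hadj1) (f.map_adj_iff.2 hadj2)
    (hlt _ (by simp)) (hlt _ (by simp)) fun h => hne (f.injective h)
  rcases SimpleGraph.cycleGraph_adj.1 (f.map_adj_iff.1 hadj) with h | h
  · have : (1 + 1 : Fin (m + 2 + 2)) = i + 1 - (i - 1) := by abel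
    rw [h] at this
    exact h1 (add_eq_left.1 this)
  · refine h3 ?_
    have : (1 + 1 : Fin (m + 2 + 2)) + (i - 1 - (i + 1)) = 0 := by abel
    rwa [h] at this

/-- The edge 46 is the middle of the induced path 1, 4, 6, 2, so neither closed neighbourhood
contains the other. -/
theorem not_homogeneous_six : ¬ Homogeneous graphSix := by
  rintro ⟨-, h⟩
  rcases h 3 5 (by decide) with h | h
  · exact absurd (@h 1 (Or.inr (by decide : graphSix.Adj 5 1)))
      (by simp only [Set.mem_insert_iff, SimpleGraph.mem_neighborSet]; decide)
  · exact absurd (@h 0 (Or.inr (by decide : graphSix.Adj 3 0)))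
      (by simp only [Set.mem_insert_iff, SimpleGraph.mem_neighborSet]; decide)

theorem not_homogeneous_eight : ¬ Homogeneous graphEight := by
  rintro ⟨-, h⟩
  rcases h 5 7 (by decide) with h | h
  · exact absurd (@h 6 (Or.inr (by decide : graphEight.Adj 7 6)))
      (by simp only [Set.mem_insert_iff, SimpleGraph.mem_neighborSet]; decide)
  · exact absurd (@h 4 (Or.inr (by decide : graphEight.Adj 5 4)))
      (by simp only [Set.mem_insert_iff, SimpleGraph.mem_neighborSet]; decide)

theorem isDAG_of_lt {p : ℕ} {D : Digraph (Fin p)} (h : ∀ u v, D.Adj u v → v < u) : IsDAG D := by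
  have key : ∀ u v, Relation.TransGen D.Adj u v → v < u := by
    intro u v huv
    induction huv with
    | single h' => exact h _ _ h'
    | tail _ h' ih => exact (h _ _ h').trans ih
  exact fun v hv => lt_irrefl _ (key v v hv)

theorem induces_six : orderSix.Induces dagSix := by
  refine ⟨⟨isDAG_of_lt ?_, ?_⟩, ?_⟩
  · change ∀ u v : Fin 6, (u, v) ∈ arrowsSix → v < u
    decide
  · change ∀ u v : Fin 6, graphSix.Adj u v ↔ (u, v) ∈ arrowsSix ∨ (v, u) ∈ arrowsSix
    decide
  · change ∀ (j : Fin 3) (u v : Fin 6), (u, v) ∈ arrowsSix →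
      v ∈ history cliquesSix j.castSucc → u ∈ history cliquesSix j.castSucc
    decide +kernel

theorem induces_eight : orderEight.Induces dagEight := by
  refine ⟨⟨isDAG_of_lt ?_, ?_⟩, ?_⟩
  · change ∀ u v : Fin 8, (u, v) ∈ arrowsEight → v < u
    decide
  · change ∀ u v : Fin 8, graphEight.Adj u v ↔ (u, v) ∈ arrowsEight ∨ (v, u) ∈ arrowsEight
    decide
  · change ∀ (j : Fin 4) (u v : Fin 8), (u, v) ∈ arrowsEight →
      v ∈ history cliquesEight j.castSucc → u ∈ history cliquesEight j.castSucc
    decide +kernel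

theorem isAncestral_sep_six_iff (i : Fin 3) : IsAncestral dagSix (orderSix.sep i) ↔ i ≠ 2 := by
  rw [orderSix_sep]
  change (∀ u v : Fin 6, (u, v) ∈ arrowsSix → _) ↔ _
  revert i
  decide

theorem isAncestral_sep_eight_iff (i : Fin 4) :
    IsAncestral dagEight (orderEight.sep i) ↔ i < 2 := by
  rw [orderEight_sep]
  change (∀ u v : Fin 8, (u, v) ∈ arrowsEight → _) ↔ _
  revert i
  decide

theorem exists_sep_six (S : Separators graphSix) : ∃ i, orderSix.sep i = S.1 := by
  obtain ⟨S, n, P, j, rfl⟩ := S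
  obtain rfl := P.length_unique orderSix
  obtain ⟨σ, τ, -, hτ, -⟩ := P.exists_rooted_six
  exact ⟨τ j, (hτ j).symm⟩

theorem exists_sep_eight (S : Separators graphEight) : ∃ i, orderEight.sep i = S.1 := by
  obtain ⟨S, n, P, j, rfl⟩ := S
  obtain rfl := P.length_unique orderEight
  obtain ⟨σ, τ, -, hτ, -⟩ := P.exists_rooted_eight
  exact ⟨τ j, (hτ j).symm⟩

theorem ncard_ancestralSeparators_six : (ancestralSeparators graphSix dagSix).ncard = 2 := by
  have h : ancestralSeparators graphSix dagSix =
      {⟨orderSix.sep 0, 3, orderSix, 0, rfl⟩, ⟨orderSix.sep 1, 3, orderSix, 1, rfl⟩} := by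
    ext S
    obtain ⟨i, hi⟩ := exists_sep_six S
    simp only [ancestralSeparators, Set.mem_ofPred_eq, Set.mem_insert_iff, Set.mem_singleton_iff,
      Subtype.ext_iff, ← hi, injective_orderSix_sep.eq_iff, isAncestral_sep_six_iff]
    clear hi
    revert i
    decide
  rw [h, Set.ncard_pair]
  simp [injective_orderSix_sep.eq_iff]

theorem ncard_ancestralSeparators_eight :
    (ancestralSeparators graphEight dagEight).ncard = 2 := by
  have h : ancestralSeparators graphEight dagEight =
      {⟨orderEight.sep 0, 4, orderEight, 0, rfl⟩, ⟨orderEight.sep 1, 4, orderEight, 1, rfl⟩} := by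
    ext S
    obtain ⟨i, hi⟩ := exists_sep_eight S
    simp only [ancestralSeparators, Set.mem_ofPred_eq, Set.mem_insert_iff, Set.mem_singleton_iff,
      Subtype.ext_iff, ← hi, injective_orderEight_sep.eq_iff, isAncestral_sep_eight_iff]
    clear hi
    revert i
    decide
  rw [h, Set.ncard_pair]
  simp [injective_orderEight_sep.eq_iff]

theorem typeIIUnion_six_subset {δ : ℝ} (hδ : 0 ≤ δ) :
    typeIIUnion graphSix δ ⊆ orderSix.typeIIParams := by
  refine Set.iUnion_subset fun n => Set.iUnion_subset fun P => ?_
  obtain rfl : n = 2 := by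
    have := P.length_unique orderSix
    omega
  obtain ⟨σ, τ, hσ, hτ, hinj, κ, hκ, hκσ⟩ := P.exists_rooted_six
  intro θ hθ
  rw [PerfectOrder.mem_typeIISet_iff δ injective_orderSix_sep hσ hτ hinj hκσ] at hθ
  exact RootedConditions.mem_typeIIParams_six hδ hκ hθ

theorem typeIIUnion_eight_subset {δ : ℝ} (hδ : 0 ≤ δ) :
    typeIIUnion graphEight δ ⊆ orderEight.typeIIParams := by
  refine Set.iUnion_subset fun n => Set.iUnion_subset fun P => ?_
  obtain rfl : n = 3 := by
    have := P.length_unique orderEight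
    omega
  obtain ⟨σ, τ, hσ, hτ, hinj, κ, hκ, hκσ⟩ := P.exists_rooted_eight
  intro θ hθ
  rw [PerfectOrder.mem_typeIISet_iff δ injective_orderEight_sep hσ hτ hinj hκσ] at hθ
  exact RootedConditions.mem_typeIIParams_eight hδ hκ hθ

end TwoGraphs

/-! ## Dimensions -/

section Dimension

variable {V : Type*} [DecidableEq V] {G : SimpleGraph V} {n : ℕ}

/-- The indices of a perfect order enumerate the cliques. -/
noncomputable def PerfectOrder.cliqueEquiv (P : PerfectOrder G n) : Fin (n + 1) ≃ Cliques G :=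
  Equiv.ofBijective (fun j => ⟨P.clique j, (P.isMaxClique_iff _).2 ⟨j, rfl⟩⟩)
    ⟨fun _ _ h => P.injective (congrArg Subtype.val h), fun C => by
      obtain ⟨j, hj⟩ := (P.isMaxClique_iff C.1).1 C.2
      exact ⟨j, Subtype.ext hj⟩⟩

/-- The indices of a perfect order in which every separator occurs once enumerate the
separators. -/
noncomputable def PerfectOrder.sepEquiv (P : PerfectOrder G n) (hinj : Function.Injective P.sep)
    (hsurj : ∀ S : Separators G, ∃ i, P.sep i = S.1) : Fin n ≃ Separators G :=
  Equiv.ofBijective (fun j => ⟨P.sep j, n, P, j, rfl⟩)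
    ⟨fun _ _ h => hinj (congrArg Subtype.val h), fun S => by
      obtain ⟨j, hj⟩ := hsurj S
      exact ⟨j, Subtype.ext hj⟩⟩

variable [Fintype V]

/-- The coordinates `α_j` and `β_j` of the multi-parameters. -/
noncomputable def PerfectOrder.paramsEquiv (P : PerfectOrder G n)
    (hinj : Function.Injective P.sep) (hsurj : ∀ S : Separators G, ∃ i, P.sep i = S.1) :
    Params G ≃L[ℝ] (Fin (n + 1) → ℝ) × (Fin n → ℝ) :=
  ((LinearEquiv.funCongrLeft ℝ ℝ P.cliqueEquiv).prodCongr
    (LinearEquiv.funCongrLeft ℝ ℝ (P.sepEquiv hinj hsurj))).toContinuousLinearEquiv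

theorem PerfectOrder.paramsEquiv_apply (P : PerfectOrder G n)
    (hinj : Function.Injective P.sep) (hsurj : ∀ S : Separators G, ∃ i, P.sep i = S.1)
    (θ : Params G) : P.paramsEquiv hinj hsurj θ = (P.alpha θ, P.beta θ) := rfl

theorem finrank_pi_prod_pi (m k : ℕ) :
    Module.finrank ℝ ((Fin m → ℝ) × (Fin k → ℝ)) = m + k := by
  simp

/-- The set lies in the range of a C¹ map whose parameters are all α_j and k of the β_j. -/
theorem PerfectOrder.dimH_le_of_beta_eq (P : PerfectOrder G n)
    (hinj : Function.Injective P.sep) (hsurj : ∀ S : Separators G, ∃ i, P.sep i = S.1)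
    {k : ℕ} {ι : Fin k → Fin n} {g : (Fin (n + 1) → ℝ) × (Fin k → ℝ) → Fin n → ℝ}
    (hg : ContDiff ℝ 1 g) {A : Set (Params G)}
    (hA : ∀ θ ∈ A, P.beta θ = g (P.alpha θ, fun i => P.beta θ (ι i))) :
    dimH A ≤ (n + 1 + k : ℕ) := by
  rw [← finrank_pi_prod_pi, ← (P.paramsEquiv hinj hsurj).dimH_image]
  refine (dimH_mono ?_).trans
    (ContDiff.dimH_range_le (f := fun x => (x.1, g x)) (contDiff_fst.prodMk hg))
  rintro _ ⟨θ, hθ, rfl⟩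
  exact ⟨(P.alpha θ, fun i => P.beta θ (ι i)),
    by rw [P.paramsEquiv_apply]; exact Prod.ext rfl (hA θ hθ).symm⟩

/-- The projection to all α_j and the chosen β_j is Lipschitz, and its image contains an open box.
The bounds -2 and -1 are chosen so that the strict inequalities of the families and of the sets B_P
hold on the box. -/
theorem PerfectOrder.le_dimH (P : PerfectOrder G n)
    (hinj : Function.Injective P.sep) (hsurj : ∀ S : Separators G, ∃ i, P.sep i = S.1)
    {k : ℕ} {ι : Fin k → Fin n} {g : (Fin (n + 1) → ℝ) → (Fin k → ℝ) → Fin n → ℝ}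
    (hg : ∀ a b i, g a b (ι i) = b i) {A : Set (Params G)}
    (hA : ∀ (θ : Params G) (b : Fin k → ℝ), (∀ j, P.alpha θ j < -2) → (∀ i, -1 < b i) →
      P.beta θ = g (P.alpha θ) b → θ ∈ A) :
    ((n + 1 + k : ℕ) : ℝ≥0∞) ≤ dimH A := by
  let O : Set ((Fin (n + 1) → ℝ) × (Fin k → ℝ)) :=
    (Set.univ.pi fun _ => Set.Iio (-2)) ×ˢ Set.univ.pi fun _ => Set.Ioi (-1)
  have hO : IsOpen O := (isOpen_set_pi Set.finite_univ fun _ _ => isOpen_Iio).prod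
    (isOpen_set_pi Set.finite_univ fun _ _ => isOpen_Ioi)
  have hne : (interior O).Nonempty := by
    rw [hO.interior_eq]
    exact ⟨(fun _ => -3, fun _ => 0), fun _ _ => by norm_num, fun _ _ => by norm_num⟩
  let π : (Fin (n + 1) → ℝ) × (Fin n → ℝ) →L[ℝ] (Fin (n + 1) → ℝ) × (Fin k → ℝ) :=
    (ContinuousLinearMap.fst ℝ _ _).prod
      (ContinuousLinearMap.pi fun i =>
        (ContinuousLinearMap.proj (ι i)).comp (ContinuousLinearMap.snd ℝ _ _))
  rw [← finrank_pi_prod_pi, ← Real.dimH_of_nonempty_interior hne,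
    ← (P.paramsEquiv hinj hsurj).dimH_image]
  refine (dimH_mono ?_).trans (π.lipschitz.dimH_image_le _)
  rintro ⟨a, b⟩ ⟨ha, hb⟩
  let θ := (P.paramsEquiv hinj hsurj).symm (a, g a b)
  have hθ : P.paramsEquiv hinj hsurj θ = (a, g a b) :=
    (P.paramsEquiv hinj hsurj).apply_symm_apply _
  have h1 : P.alpha θ = a := congrArg Prod.fst hθ
  have h2 : P.beta θ = g a b := congrArg Prod.snd hθ
  refine ⟨_, ⟨θ, hA θ b (fun j => ?_) (fun i => hb i trivial) (by rw [h1, h2]), rfl⟩, ?_⟩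
  · rw [h1]; exact ha j trivial
  · rw [hθ]
    exact Prod.ext rfl (funext fun i => hg a b i)

/-- Makes the union of the sets B_P countable, so that its dimension is the supremum of theirs. -/
instance finite_perfectOrder : Finite (PerfectOrder G n) :=
  Finite.of_injective (fun P => P.clique) fun P Q h => by
    cases P; cases Q; congr

theorem PerfectOrder.dimH_le_of_rooted (Q : PerfectOrder G (n + 1))
    (hinj : Function.Injective Q.sep) (hsurj : ∀ S : Separators G, ∃ i, Q.sep i = S.1)
    {δ : ℝ} {ρ : Fin (n + 1 + 1)} {κ : Fin (n + 1) → Fin (n + 1 + 1)} {t : Fin (n + 1)}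
    {A : Set (Params G)} (hA : ∀ θ ∈ A, Q.RootedConditions δ ρ κ t θ) :
    dimH A ≤ (n + 1 + 1 + 1 : ℕ) := by
  refine Q.dimH_le_of_beta_eq hinj hsurj (ι := fun _ : Fin 1 => t)
    (g := fun x i => if i = t then x.2 0 else
      x.1 (κ i) + (((Q.clique (κ i)).card : ℝ) - (Q.sep i).card) / 2) ?_ fun θ hθ => ?_
  · refine contDiff_pi.2 fun i => ?_
    split_ifs <;> fun_prop
  · funext i
    by_cases h : i = t
    · simp [h]
    · have := (hA θ hθ).1 i h
      simp only [h, if_false]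
      linarith

theorem PerfectOrder.le_dimH_typeIISet (Q : PerfectOrder G (n + 1))
    (hinj : Function.Injective Q.sep) (hsurj : ∀ S : Separators G, ∃ i, Q.sep i = S.1)
    {δ : ℝ} (hδ : δ ≤ 1) (hcard : ∀ i, ((Q.clique i.succ).card : ℝ) - (Q.sep i).card ≤ 3)
    (hzero : (Q.clique 0).card = 3) (hsucc : (Q.clique (Fin.succ 0)).card = 3)
    (hsep : (Q.sep 0).card = 2) :
    ((n + 1 + 1 + 1 : ℕ) : ℝ≥0∞) ≤ dimH (Q.typeIISet δ) := by
  refine Q.le_dimH hinj hsurj (ι := fun _ : Fin 1 => 0)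
    (g := fun a b i => if i = 0 then b 0 else
      a i.succ + (((Q.clique i.succ).card : ℝ) - (Q.sep i).card) / 2)
    (fun a b i => by simp [Subsingleton.elim i 0]) fun θ b hα hb hβ => ?_
  rw [mem_typeIISet_iff (P := Q) δ (σ := id) (τ := id) (κ := Fin.succ) hinj (fun _ => rfl)
    (fun _ => rfl) Function.injective_id fun _ => rfl]
  refine ⟨fun i hi => ?_, fun i => ?_, ?_, ?_⟩
  · have hi' : i ≠ 0 := hi
    rw [hβ]
    simp [hi']
  · have := hα i.succ
    have := hcard i
    linarith
  · have := hα 0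
    simp only [id, hzero, hsep]
    norm_num
    linarith
  · have := hα 0
    have := hα (Fin.succ 0)
    have := hb 0
    rw [hβ]
    simp only [id, hzero, hsep, hsucc, if_true]
    norm_num at *
    linarith

theorem dimH_familySix : dimH familySix = 6 := by
  refine le_antisymm ?_ ?_
  · refine orderSix.dimH_le_of_beta_eq injective_orderSix_sep exists_sep_six (ι := ![0, 1])
      (g := fun x => ![x.2 0, x.2 1, x.1 3 + 1 / 2]) ?_ ?_
    · refine contDiff_pi.2 fun i => ?_
      fin_cases i <;> dsimp <;> fun_prop
    · rintro θ ⟨-, -, -, h⟩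
      funext i
      fin_cases i
      · rfl
      · rfl
      · dsimp
        linarith
  · refine orderSix.le_dimH injective_orderSix_sep exists_sep_six (ι := ![0, 1])
      (g := fun a b => ![b 0, b 1, a 3 + 1 / 2]) ?_ ?_
    · intro a b i
      fin_cases i <;> rfl
    · intro θ b hα hb hβ
      have a0 := hα 0
      have a1 := hα 1
      have a2 := hα 2
      have b0 := hb 0
      have b1 := hb 1
      refine ⟨fun j => (hα j).trans (by norm_num), ?_, ?_, ?_⟩ <;> simp [hβ] <;> linarith

theorem dimH_familyEight : dimH familyEight = 7 := by
  refine le_antisymm ?_ ?_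
  · refine orderEight.dimH_le_of_beta_eq injective_orderEight_sep exists_sep_eight (ι := ![0, 1])
      (g := fun x => ![x.2 0, x.2 1, x.1 3 + 1, x.1 4 + 1 / 2]) ?_ ?_
    · refine contDiff_pi.2 fun i => ?_
      fin_cases i <;> dsimp <;> fun_prop
    · rintro θ ⟨-, -, -, -, h, h'⟩
      funext i
      fin_cases i
      · rfl
      · rfl
      · dsimp
        linarith
      · dsimp
        linarith
  · refine orderEight.le_dimH injective_orderEight_sep exists_sep_eight (ι := ![0, 1])
      (g := fun a b => ![b 0, b 1, a 3 + 1, a 4 + 1 / 2]) ?_ ?_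
    · intro a b i
      fin_cases i <;> rfl
    · intro θ b hα hb hβ
      have a0 := hα 0
      have a1 := hα 1
      have a2 := hα 2
      have a3 := hα 3
      have b0 := hb 0
      have b1 := hb 1
      refine ⟨fun j => (hα j).trans (by norm_num), ?_, ?_, ?_, ?_, ?_⟩ <;> simp [hβ] <;> linarith

theorem dimH_typeIIUnion_six {δ : ℝ} (hδ : δ ≤ 1) : dimH (typeIIUnion graphSix δ) = 5 := by
  refine le_antisymm ?_ ?_
  · simp only [typeIIUnion, dimH_iUnion]
    refine iSup_le fun n => iSup_le fun P => ?_
    obtain rfl : n = 2 := by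
      have := P.length_unique orderSix
      omega
    obtain ⟨σ, τ, hσ, hτ, hinj, κ, -, hκσ⟩ := P.exists_rooted_six
    exact orderSix.dimH_le_of_rooted injective_orderSix_sep exists_sep_six fun θ hθ =>
      (PerfectOrder.mem_typeIISet_iff δ injective_orderSix_sep hσ hτ hinj hκσ θ).1 hθ
  · refine (orderSix.le_dimH_typeIISet injective_orderSix_sep exists_sep_six hδ (fun i => ?_)
      rfl rfl (by rw [orderSix_sep]; rfl)).trans
      (dimH_mono (Set.subset_iUnion_of_subset 2 (Set.subset_iUnion_of_subset orderSix
        subset_rfl)))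
    rw [card_clique_six, card_sep_six]
    fin_cases i <;> simp <;> norm_num

theorem dimH_typeIIUnion_eight {δ : ℝ} (hδ : δ ≤ 1) : dimH (typeIIUnion graphEight δ) = 6 := by
  refine le_antisymm ?_ ?_
  · simp only [typeIIUnion, dimH_iUnion]
    refine iSup_le fun n => iSup_le fun P => ?_
    obtain rfl : n = 3 := by
      have := P.length_unique orderEight
      omega
    obtain ⟨σ, τ, hσ, hτ, hinj, κ, -, hκσ⟩ := P.exists_rooted_eight
    exact orderEight.dimH_le_of_rooted injective_orderEight_sep exists_sep_eight fun θ hθ =>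
      (PerfectOrder.mem_typeIISet_iff δ injective_orderEight_sep hσ hτ hinj hκσ θ).1 hθ
  · refine (orderEight.le_dimH_typeIISet injective_orderEight_sep exists_sep_eight hδ
      (fun i => ?_) rfl rfl (by rw [orderEight_sep]; rfl)).trans
      (dimH_mono (Set.subset_iUnion_of_subset 3 (Set.subset_iUnion_of_subset orderEight
        subset_rfl)))
    rw [card_clique_eight, card_sep_eight]
    fin_cases i <;> simp <;> norm_num

/-- Equality would place a set of dimension 6 inside one of dimension 5. -/
theorem typeIIUnion_six_ssubset {δ : ℝ} (hδ0 : 0 ≤ δ) (hδ1 : δ ≤ 1) :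
    typeIIUnion graphSix δ ⊂ orderSix.typeIIParams := by
  refine (typeIIUnion_six_subset hδ0).ssubset_of_ne fun h => ?_
  have := dimH_mono (familySix_subset.trans h.symm.subset)
  rw [dimH_familySix, dimH_typeIIUnion_six hδ1] at this
  norm_num at this

theorem typeIIUnion_eight_ssubset {δ : ℝ} (hδ0 : 0 ≤ δ) (hδ1 : δ ≤ 1) :
    typeIIUnion graphEight δ ⊂ orderEight.typeIIParams := by
  refine (typeIIUnion_eight_subset hδ0).ssubset_of_ne fun h => ?_
  have := dimH_mono (familyEight_subset.trans h.symm.subset)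
  rw [dimH_familyEight, dimH_typeIIUnion_eight hδ1] at this
  norm_num at this

end Dimension

end LetacMassam

theorem mainTheorem1 :
    -- the graph on six vertices
    ((LetacMassam.Decomposable LetacMassam.graphSix ∧
        ¬ LetacMassam.Homogeneous LetacMassam.graphSix) ∧
      LetacMassam.orderSix.Induces LetacMassam.dagSix ∧
      (LetacMassam.ancestralSeparators LetacMassam.graphSix LetacMassam.dagSix).ncard = 2 ∧
      (LetacMassam.IsAncestral LetacMassam.dagSix (LetacMassam.orderSix.sep 0) ∧
        LetacMassam.IsAncestral LetacMassam.dagSix (LetacMassam.orderSix.sep 1)) ∧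
      (∀ θ ∈ LetacMassam.familySix,
        LetacMassam.orderSix.CondB1 θ ∧ LetacMassam.orderSix.CondB2 θ) ∧
      dimH LetacMassam.familySix = 6 ∧
      (∀ δ : ℝ, δ = 0 ∨ δ = 1 →
        dimH (LetacMassam.typeIIUnion LetacMassam.graphSix δ) = 5 ∧
        LetacMassam.typeIIUnion LetacMassam.graphSix δ ⊂ LetacMassam.orderSix.typeIIParams)) ∧
    -- the graph on eight vertices
    ((LetacMassam.Decomposable LetacMassam.graphEight ∧
        ¬ LetacMassam.Homogeneous LetacMassam.graphEight) ∧
      LetacMassam.orderEight.Induces LetacMassam.dagEight ∧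
      (LetacMassam.ancestralSeparators LetacMassam.graphEight LetacMassam.dagEight).ncard = 2 ∧
      (LetacMassam.IsAncestral LetacMassam.dagEight (LetacMassam.orderEight.sep 0) ∧
        LetacMassam.IsAncestral LetacMassam.dagEight (LetacMassam.orderEight.sep 1)) ∧
      (∀ θ ∈ LetacMassam.familyEight,
        LetacMassam.orderEight.CondB1 θ ∧ LetacMassam.orderEight.CondB2 θ) ∧
      dimH LetacMassam.familyEight = 7 ∧
      (∀ δ : ℝ, δ = 0 ∨ δ = 1 →
        dimH (LetacMassam.typeIIUnion LetacMassam.graphEight δ) = 6 ∧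
        LetacMassam.typeIIUnion LetacMassam.graphEight δ ⊂
          LetacMassam.orderEight.typeIIParams)) ∧
    -- the failure of part (II) of the conjecture
    (∀ δ : ℝ, δ = 0 ∨ δ = 1 → ¬ LetacMassam.ConjectureII δ) := by
  have hδ : ∀ δ : ℝ, δ = 0 ∨ δ = 1 → 0 ≤ δ ∧ δ ≤ 1 := by rintro δ (rfl | rfl) <;> norm_num
  refine ⟨⟨⟨LetacMassam.isPerfectElimination_six.decomposable, LetacMassam.not_homogeneous_six⟩,
      LetacMassam.induces_six, LetacMassam.ncard_ancestralSeparators_six,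
      ⟨(LetacMassam.isAncestral_sep_six_iff 0).2 (by decide),
        (LetacMassam.isAncestral_sep_six_iff 1).2 (by decide)⟩,
      fun θ hθ => LetacMassam.familySix_subset hθ, LetacMassam.dimH_familySix,
      fun δ h => ⟨LetacMassam.dimH_typeIIUnion_six (hδ δ h).2,
        LetacMassam.typeIIUnion_six_ssubset (hδ δ h).1 (hδ δ h).2⟩⟩,
    ⟨⟨LetacMassam.isPerfectElimination_eight.decomposable, LetacMassam.not_homogeneous_eight⟩,
      LetacMassam.induces_eight, LetacMassam.ncard_ancestralSeparators_eight,
      ⟨(LetacMassam.isAncestral_sep_eight_iff 0).2 (by decide),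
        (LetacMassam.isAncestral_sep_eight_iff 1).2 (by decide)⟩,
      fun θ hθ => LetacMassam.familyEight_subset hθ, LetacMassam.dimH_familyEight,
      fun δ h => ⟨LetacMassam.dimH_typeIIUnion_eight (hδ δ h).2,
        LetacMassam.typeIIUnion_eight_ssubset (hδ δ h).1 (hδ δ h).2⟩⟩,
    fun δ h hc => (LetacMassam.typeIIUnion_six_ssubset (hδ δ h).1 (hδ δ h).2).ne
      (hc 6 LetacMassam.graphSix LetacMassam.isPerfectElimination_six.decomposable
        LetacMassam.not_homogeneous_six 3 LetacMassam.orderSix)⟩
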